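/- Let $n\ge 1$, index the rows and columns of $n\times n$ matrices by $\mathbb Z/n\mathbb Z$, let $P$ be the permutation matrix whose entries $(i,i+1)$ equal $1$, and let $J$ be the all-ones matrix. The bipartite graph of a $(0,1)$-matrix $A$ has one vertex for each row and one for each column, row $i$ and column $j$ being adjacent iff $A_{ij}=1$; $A$ is called a biadjacency matrix of every graph isomorphic to it. A bipartite circulant on $2n$ vertices is a graph that has an $n\times n$ circulant $(0,1)$-matrix as a biadjacency matrix. The zero forcing number $Z(G)$ is the least size of a set $B$ of vertices such that, starting with exactly the vertices of $B$ black, all vertices become black by repeated application of the rule: a black vertex with exactly one white neighbour turns that neighbour black. For integers $a,g$ and positive integers $d\mid n$ and $c\mid d$ write $[a]_d=\{a+td : t\in\mathbb Z\}\subseteq\mathbb Z/n\mathbb Z$ and $[[g]_c]_d=\bigcup_{s\in\mathbb Z}[g+sc]_d$, and let $P^{[a]_d}$ and $P^{[[g]_c]_d}$ be the sums of $P^x$ over all $x\in[a]_d$ and all $x\in[[g]_c]_d$, respectively. Let $G$ be a connected $k$-regular bipartite circulant on $2n$ vertices with $Z(G)=2(k-1)$. Then there is a matrix $M$ of one of the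 following forms such that every $n\times n$ biadjacency matrix of $G$ arises from $M$ by independent permutations of rows and columns: 1. $M=I+P+P^2+\cdots+P^{k-1}$ with $2\le k\le n$; 2. $M=J-P^{\alpha}-P^{\alpha+i}-\cdots-P^{\alpha+ri}$ for some integers $\alpha$, $r\ge 0$ and $i$ such that $\gcd(i,n)>1$ and the order of $i$ in $\mathbb Z/n\mathbb Z$ is greater than $r+1$; 3. $M=P^{[[\gamma_1]_c]_d}+\cdots+P^{[[\gamma_{c-1}]_c]_d}+P^{\beta}+P^{[\beta+\alpha]_d}+\cdots+P^{[\beta+l\alpha]_d}$, where $d$ is a positive divisor of $n$, $c=\gcd(d,\alpha)$, $1\le l<d/c$, the integers $\beta,\gamma_1,\dots,\gamma_{c-1}$ are pairwise incongruent modulo $c$ (so that all powers of $P$ that occur are distinct), and one of the following holds: (a) $\alpha\in[[\gamma_j]_c]_d$ for some $1\le j\le c-1$; or (b) $\beta\in[-m\alpha]_d$ for some $m$ with $1\le m<l$ (so that $P^{[0]_d}$ and $P^{[\alpha]_d}$ are terms of the sum) and $d/c\le m+2(l-m)+1$. Conversely, every matrix of the form 1 (for any $2\le k\le n$), 2 or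 3 is a circulant $(0,1)$-matrix whose bipartite graph $G$ is connected and $k$-regular for some $k$, with $Z(G)=2(k-1)$. -/

import Mathlib

namespace BipCirc

/-! ### Zero forcing -/

/-- One application of the zero forcing rule: a black vertex `u` whose unique white neighbour
is `w` turns `w` black. -/
def ForceStep {V : Type*} (G : SimpleGraph V) (B B' : Set V) : Prop :=
  ∃ u ∈ B, ∃ w ∉ B, G.Adj u w ∧ (∀ x, G.Adj u x → x ∉ B → x = w) ∧ B' = insert w B

/-- `B` is a zero forcing set: repeated applications of the rule colour all vertices black. -/
def IsZeroForcingSet {V : Type*} (G : SimpleGraph V) (B : Set V) : Prop :=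
  Relation.ReflTransGen (ForceStep G) B Set.univ

/-- The zero forcing number `Z(G)` of a finite graph: the least size of a zero forcing set
(the whole vertex set is always one). -/
noncomputable def zeroForcingNumber {V : Type*} (G : SimpleGraph V) : ℕ :=
  sInf {m | ∃ B : Finset V, B.card = m ∧ IsZeroForcingSet G (B : Set V)}

/-! ### Bipartite graphs of matrices, bipartite circulants -/

/-- The bipartite graph with a vertex `inl i` for each row and `inr j` for each column of `A`,
where row `i` is joined to column `j` if and only if `A i j = 1`. -/
def bipGraph {m n : Type*} (A : Matrix m n ℤ) : SimpleGraph (m ⊕ n) where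
  Adj x y := match x, y with
    | Sum.inl i, Sum.inr j => A i j = 1
    | Sum.inr j, Sum.inl i => A i j = 1
    | _, _ => False
  symm := ⟨by
    rintro (i | i) (j | j) h
    · exact h
    · exact h
    · exact h
    · exact h⟩
  loopless := ⟨by
    rintro (i | i) h
    · exact h
    · exact h⟩

instance {m n : Type*} (A : Matrix m n ℤ) : DecidableRel (bipGraph A).Adj
  | Sum.inl i, Sum.inr j => inferInstanceAs (Decidable (A i j = 1))
  | Sum.inr j, Sum.inl i => inferInstanceAs (Decidable (A i j = 1))
  | Sum.inl _, Sum.inl _ => isFalse id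
  | Sum.inr _, Sum.inr _ => isFalse id

/-- `A` is a (0,1) matrix. -/
def IsZeroOne {m n : Type*} (A : Matrix m n ℤ) : Prop :=
  ∀ i j, A i j = 0 ∨ A i j = 1

/-- `A` is a circulant matrix (rows and columns are indexed by `ℤ/nℤ`). -/
def IsCirculant {n : ℕ} (A : Matrix (ZMod n) (ZMod n) ℤ) : Prop :=
  ∃ v : ZMod n → ℤ, A = Matrix.circulant v

/-- The (0,1) matrix `A` is a biadjacency matrix of the (unlabelled) graph `G`. -/
def IsBiadjacencyMatrix {V : Type*} (G : SimpleGraph V) {m n : Type*} (A : Matrix m n ℤ) : Prop :=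
  IsZeroOne A ∧ Nonempty (G ≃g bipGraph A)

/-- `G` is a bipartite circulant on `2n` vertices. -/
def IsBipartiteCirculant {V : Type*} (G : SimpleGraph V) (n : ℕ) : Prop :=
  ∃ A : Matrix (ZMod n) (ZMod n) ℤ, IsCirculant A ∧ IsBiadjacencyMatrix G A

/-- `A` arises from `M` by independent permutations of the rows and of the columns. -/
def PermEquiv {m n : Type*} (A M : Matrix m n ℤ) : Prop :=
  ∃ (σ : Equiv.Perm m) (τ : Equiv.Perm n), A = M.submatrix σ τ

/-! ### The three families -/

/-- The permutation matrix of the `n`-cycle: the entries `(i, i + 1)` are `1`. -/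
def P (n : ℕ) : Matrix (ZMod n) (ZMod n) ℤ :=
  Matrix.of fun i j => if j = i + 1 then 1 else 0

/-- The all-ones matrix. -/
def J (n : ℕ) : Matrix (ZMod n) (ZMod n) ℤ :=
  Matrix.of fun _ _ => 1

/-- `P^{[a]_d} = P^a + P^(a+d) + P^(a+2d) + ⋯ + P^(a-d)`; the number of summands is the order
of `d` in `ℤ/nℤ`. -/
noncomputable def PClass (n : ℕ) [NeZero n] (a d : ℕ) : Matrix (ZMod n) (ZMod n) ℤ :=
  ∑ t ∈ Finset.range (addOrderOf (d : ZMod n)), P n ^ (a + t * d)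

/-- `P^{[[g]_c]_d} = P^{[g]_d} + P^{[g+c]_d} + P^{[g+2c]_d} + ⋯ + P^{[g-c]_d}`; the number of
terms is the order of `c` in `ℤ/gcd(n,d)ℤ`. -/
noncomputable def PClassClass (n : ℕ) [NeZero n] (g c d : ℕ) : Matrix (ZMod n) (ZMod n) ℤ :=
  ∑ t ∈ Finset.range (addOrderOf (c : ZMod (Nat.gcd n d))), PClass n (g + t * c) d

/-- The class `[a]_d = {a, a + d, a + 2d, …}` in `ℤ/nℤ`. -/
def resClass {n : ℕ} (a d : ZMod n) : Set (ZMod n) :=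
  {x | ∃ t : ℕ, x = a + (t : ZMod n) * d}

/-- The double class `[[g]_c]_d`, the union of the classes `[g + sc]_d`, in `ℤ/nℤ`. -/
def resClassClass {n : ℕ} (g c d : ZMod n) : Set (ZMod n) :=
  {x | ∃ s : ℕ, x ∈ resClass (g + (s : ZMod n) * c) d}

/-- `I + P + ⋯ + P^(k-1)`, where `2 ≤ k ≤ n`. -/
def IsFamily1 (n : ℕ) [NeZero n] (k : ℕ) (M : Matrix (ZMod n) (ZMod n) ℤ) : Prop :=
  2 ≤ k ∧ k ≤ n ∧ M = ∑ t ∈ Finset.range k, P n ^ t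

/-- `J - P^a - P^(a+i) - ⋯ - P^(a+ri)`, where `gcd(i,n) > 1` and the order of `i` in `ℤ/nℤ` is
greater than `r + 1`. -/
def IsFamily2 (n : ℕ) [NeZero n] (M : Matrix (ZMod n) (ZMod n) ℤ) : Prop :=
  ∃ a r i : ℕ, 1 < Nat.gcd i n ∧ r + 1 < addOrderOf (i : ZMod n) ∧
    M = J n - ∑ t ∈ Finset.range (r + 1), P n ^ (a + t * i)

/-- `P^{[[γ₁]_c]_d} + ⋯ + P^{[[γ_{c-1}]_c]_d} + P^β + P^{[β+α]_d} + ⋯ + P^{[β+lα]_d}`, where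
`d ∣ n`, `c = gcd(d,α)`, `l ≥ 1`, all powers of `P` that occur are distinct (that is,
`β, γ₁, …, γ_{c-1}` are pairwise incongruent modulo `c`, and `l < d/c`), and either `α` lies in
one of the complete double classes, or `β ∈ [-mα]_d` with `1 ≤ m < l` and the `m + 2(l-m) + 1`
classes `[β-(l-m)α]_d, …, [(l-m)α]_d` exhaust the `d/c` classes of the double class of `β`. -/
def IsFamily3 (n : ℕ) [NeZero n] (M : Matrix (ZMod n) (ZMod n) ℤ) : Prop :=
  ∃ (d α β l c : ℕ) (γ : Fin (c - 1) → ℕ),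
    d ∣ n ∧ c = Nat.gcd d α ∧ 1 ≤ l ∧ l < d / c ∧
    (∀ j j', γ j ≡ γ j' [MOD c] → j = j') ∧ (∀ j, ¬ γ j ≡ β [MOD c]) ∧
    ((∃ j, (α : ZMod n) ∈ resClassClass (γ j : ZMod n) (c : ZMod n) (d : ZMod n)) ∨
      (∃ m : ℕ, 1 ≤ m ∧ m < l ∧
        (β : ZMod n) ∈ resClass (-((m : ZMod n) * (α : ZMod n))) (d : ZMod n) ∧
        d / c ≤ m + 2 * (l - m) + 1)) ∧
    M = ∑ j, PClassClass n (γ j) c d + P n ^ β + ∑ t ∈ Finset.Icc 1 l, PClass n (β + t * α) d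

end BipCirc

open BipCirc

/-! Write the circulant as `circMat S`: row `i` meets column `j` iff `j - i ∈ S`, and `k` is the
size of `S`. A set of vertices forces everything iff no proper stalled set contains it, so the
argument works with stalled pairs `(R, C)` of rows and columns.

Each side of a forcing set has at least `k - 1` vertices: even with the other side entirely black, a
first force needs a vertex with `k - 1` black neighbours. In case of equality each side is a
neighbourhood minus one vertex, and the two vertices concerned can be taken adjacent
(`exists_forcing_pair`). In particular, for every proper column set `C ⊇ S` some translate of `S`
has exactly one element outside `C`.

`exists_structure` exploits this condition for `C = S` and for unions of cosets. With `C = S`, some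
translate `S + x` leaves `S` only at a point `b + x`, so `S` consists of a progression of difference
`x` ending in `b` and of full cosets of `⟨x⟩`. If `x` generates the group this is family 1; if all
other cosets are full it is family 2. Otherwise `C = S + ⟨x⟩` shows that `b` is alone in its coset.
Take a maximal subgroup `H` such that `b` is alone in `b + H` and `S` is otherwise a union of cosets
of `H`. Either `S` contains everything outside `b + H`, which is family 2 again, or the same
argument modulo `H` gives a progression of cosets of `H`, and maximality puts everything outside the
coset of `b` modulo `K = H + ⟨α⟩` into `S`. This is family 3; if `K` is the whole group, the forcing
pair also yields `t • α ∈ H` for some `1 ≤ t ≤ 2 * l` (`exists_nsmul_mem_of_forcing`), whence the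
inequality in (b).

Conversely, forcing sets of size `2 * (k - 1)` are explicit: for an interval rows and columns force
each other alternately, while in families 2 and 3 each side is filled using only the initial
vertices of the other (`zeroForcingNumber_eq_of_fill`). -/

namespace BipCirc

/-! ### Zero forcing and stalled sets -/

/-- No force is possible from the set `X` of black vertices. -/
def IsStalled {V : Type*} (G : SimpleGraph V) (X : Set V) : Prop :=
  ∀ u ∈ X, ∀ w, G.Adj u w → (∀ x, G.Adj u x → x ≠ w → x ∈ X) → w ∈ X

/-- No force leads out of a stalled superset. Conversely, a set that is not stalled admits a force,
and the number of white vertices decreases. -/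
theorem isZeroForcingSet_iff {V : Type*} [Finite V] {G : SimpleGraph V} {B : Set V} :
    IsZeroForcingSet G B ↔ ∀ X, IsStalled G X → B ⊆ X → X = Set.univ := by
  constructor
  · intro h X hX
    induction h using Relation.ReflTransGen.head_induction_on with
    | refl => exact fun h => Set.univ_subset_iff.1 h
    | head hs _ ih =>
      intro hB
      apply ih
      obtain ⟨u, hu, w, hw, huw, hx, rfl⟩ := hs
      refine Set.insert_subset (hX u (hB hu) w huw fun x hux hxw => ?_) hB
      by_contra hxX
      exact hxw (hx x hux fun h => hxX (hB h))
  · induction hm : (Bᶜ).ncard using Nat.strong_induction_on generalizing B with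
    | _ m ih =>
      intro h
      by_cases hB : B = Set.univ
      · rw [hB]; exact Relation.ReflTransGen.refl
      have hns : ¬ IsStalled G B := fun hst => hB (h B hst subset_rfl)
      simp only [IsStalled, not_forall] at hns
      obtain ⟨u, hu, w, huw, hx, hw⟩ := hns
      refine Relation.ReflTransGen.head (b := insert w B) ⟨u, hu, w, hw, huw, ?_, rfl⟩ ?_
      · intro x hux hxB
        by_contra hxw
        exact hxB (hx x hux hxw)
      · refine ih _ ?_ rfl fun X hX hBX => h X hX ((Set.subset_insert _ _).trans hBX)
        rw [← hm]
        refine Set.ncard_lt_ncard ?_ (Set.toFinite _)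
        refine ⟨Set.compl_subset_compl.2 (Set.subset_insert _ _), fun hsub => ?_⟩
        exact hsub (show w ∈ Bᶜ from hw) (Set.mem_insert _ _)

theorem exists_card_eq_zeroForcingNumber {V : Type*} [Fintype V] (G : SimpleGraph V) :
    ∃ B : Finset V, B.card = zeroForcingNumber G ∧ IsZeroForcingSet G (B : Set V) :=
  Nat.sInf_mem (s := {m | ∃ B : Finset V, B.card = m ∧ IsZeroForcingSet G (B : Set V)})
    ⟨_, Finset.univ, rfl, by rw [Finset.coe_univ]; exact Relation.ReflTransGen.refl⟩

theorem zeroForcingNumber_le {V : Type*} {G : SimpleGraph V} {B : Finset V}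
    (h : IsZeroForcingSet G (B : Set V)) : zeroForcingNumber G ≤ B.card :=
  Nat.sInf_le ⟨B, rfl, h⟩

theorem IsStalled.preimage {V W : Type*} {G : SimpleGraph V} {H : SimpleGraph W} (φ : G ≃g H)
    {X : Set W} (hX : IsStalled H X) : IsStalled G (φ ⁻¹' X) := by
  intro u hu w huw h
  refine hX (φ u) hu (φ w) (φ.map_adj_iff.2 huw) fun x hux hxw => ?_
  have := h (φ.symm x) (by rw [← φ.map_adj_iff]; simpa using hux)
    (fun h => hxw (by rw [← h]; simp))
  simpa using this

theorem zeroForcingNumber_le_of_iso {V W : Type*} [Fintype V] [Finite W] {G : SimpleGraph V}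
    {H : SimpleGraph W} (φ : G ≃g H) : zeroForcingNumber H ≤ zeroForcingNumber G := by
  obtain ⟨B, hB, hz⟩ := exists_card_eq_zeroForcingNumber G
  rw [← hB, ← Finset.card_map φ.toEquiv.toEmbedding]
  refine zeroForcingNumber_le (isZeroForcingSet_iff.2 fun X hX hBX => ?_)
  have := isZeroForcingSet_iff.1 hz _ (hX.preimage φ) fun v hv =>
    hBX (Finset.mem_coe.2 (Finset.mem_map_of_mem _ hv))
  refine Set.eq_univ_of_forall fun w => ?_
  have h2 : φ.symm w ∈ φ ⁻¹' X := this ▸ Set.mem_univ _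
  simpa using h2

theorem zeroForcingNumber_congr {V W : Type*} [Fintype V] [Fintype W] {G : SimpleGraph V}
    {H : SimpleGraph W} (φ : G ≃g H) : zeroForcingNumber G = zeroForcingNumber H :=
  le_antisymm (zeroForcingNumber_le_of_iso φ.symm) (zeroForcingNumber_le_of_iso φ)

/-! ### The circulant matrix of a set -/

open Classical in
/-- The circulant (0,1)-matrix `∑ x ∈ S, P ^ x`. -/
noncomputable def circMat {n : ℕ} (S : Set (ZMod n)) : Matrix (ZMod n) (ZMod n) ℤ :=
  Matrix.of fun i j => if j - i ∈ S then 1 else 0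

theorem circMat_eq_one {n : ℕ} {S : Set (ZMod n)} {i j : ZMod n} :
    circMat S i j = 1 ↔ j - i ∈ S := by
  simp [circMat]

theorem isZeroOne_circMat {n : ℕ} (S : Set (ZMod n)) : IsZeroOne (circMat S) := by
  intro i j
  by_cases h : j - i ∈ S <;> simp [circMat, h]

theorem isCirculant_circMat {n : ℕ} (S : Set (ZMod n)) : IsCirculant (circMat S) := by
  classical
  refine ⟨fun x => if -x ∈ S then 1 else 0, ?_⟩
  ext i j
  simp [circMat, Matrix.circulant_apply]

theorem IsCirculant.exists_eq_circMat {n : ℕ} {A : Matrix (ZMod n) (ZMod n) ℤ}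
    (hA : IsCirculant A) (h01 : IsZeroOne A) : ∃ S : Set (ZMod n), A = circMat S := by
  obtain ⟨v, rfl⟩ := hA
  refine ⟨{x | v (-x) = 1}, ?_⟩
  ext i j
  have := h01 i j
  simp only [Matrix.circulant_apply] at this
  rcases this with h | h <;> simp [circMat, Matrix.circulant_apply, h]

/-- The sets of black rows `R` and black columns `C` allow no force in the bipartite graph of
`circMat S`. -/
def Stalled {n : ℕ} (S R C : Set (ZMod n)) : Prop :=
  (∀ r ∈ R, ∀ s ∈ S, (∀ s' ∈ S, s' ≠ s → r + s' ∈ C) → r + s ∈ C) ∧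
    ∀ v ∈ C, ∀ s ∈ S, (∀ s' ∈ S, s' ≠ s → v - s' ∈ R) → v - s ∈ R

theorem isStalled_bipGraph_circMat_iff {n : ℕ} {S : Set (ZMod n)}
    {X : Set (ZMod n ⊕ ZMod n)} :
    IsStalled (bipGraph (circMat S)) X ↔ Stalled S (Sum.inl ⁻¹' X) (Sum.inr ⁻¹' X) := by
  constructor
  · intro h
    constructor
    · intro r hr s hs hs'
      refine h (Sum.inl r) hr (Sum.inr (r + s)) (circMat_eq_one.2 (by simpa using hs)) ?_
      rintro (x | x) hx hxw
      · exact hx.elim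
      · have := hs' (x - r) (circMat_eq_one.1 hx) (fun h => hxw (by rw [← h]; simp))
        simpa using this
    · intro v hv s hs hs'
      refine h (Sum.inr v) hv (Sum.inl (v - s)) (circMat_eq_one.2 (by simpa using hs)) ?_
      rintro (x | x) hx hxw
      · have := hs' (v - x) (circMat_eq_one.1 hx) (fun h => hxw (by rw [← h]; simp))
        simpa using this
      · exact hx.elim
  · rintro ⟨h1, h2⟩ (u | u) hu (w | w) huw hx
    · exact huw.elim
    · have := h1 u hu (w - u) (circMat_eq_one.1 huw) fun s' hs' hne =>
        hx (Sum.inr (u + s')) (circMat_eq_one.2 (by simpa using hs')) fun h =>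
          hne (by rw [← Sum.inr_injective h]; ring)
      simpa using this
    · have := h2 u hu (u - w) (circMat_eq_one.1 huw) fun s' hs' hne =>
        hx (Sum.inl (u - s')) (circMat_eq_one.2 (by simpa using hs')) fun h =>
          hne (by rw [← Sum.inl_injective h]; ring)
      simpa using this
    · exact huw.elim

theorem isZeroForcingSet_bipGraph_circMat_iff {n : ℕ} [NeZero n] {S : Set (ZMod n)}
    {B : Set (ZMod n ⊕ ZMod n)} :
    IsZeroForcingSet (bipGraph (circMat S)) B ↔ ∀ R C, Stalled S R C →
      Sum.inl ⁻¹' B ⊆ R → Sum.inr ⁻¹' B ⊆ C → R = Set.univ ∧ C = Set.univ := by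
  rw [isZeroForcingSet_iff]
  constructor
  · intro h R C hRC hR hC
    have := h (Sum.inl '' R ∪ Sum.inr '' C) (isStalled_bipGraph_circMat_iff.2 (by
      simpa [Set.preimage_image_eq _ Sum.inl_injective,
        Set.preimage_image_eq _ Sum.inr_injective] using hRC)) (by
      rintro (x | x) hx
      · exact Or.inl ⟨x, hR hx, rfl⟩
      · exact Or.inr ⟨x, hC hx, rfl⟩)
    constructor
    · refine Set.eq_univ_of_forall fun x => ?_
      have hx : Sum.inl x ∈ (Sum.inl '' R ∪ Sum.inr '' C) := this ▸ Set.mem_univ _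
      simpa using hx
    · refine Set.eq_univ_of_forall fun x => ?_
      have hx : Sum.inr x ∈ (Sum.inl '' R ∪ Sum.inr '' C) := this ▸ Set.mem_univ _
      simpa using hx
  · intro h X hX hBX
    obtain ⟨h1, h2⟩ := h _ _ (isStalled_bipGraph_circMat_iff.1 hX)
      (Set.preimage_mono hBX) (Set.preimage_mono hBX)
    refine Set.eq_univ_of_forall ?_
    rintro (x | x)
    · exact Set.eq_univ_iff_forall.1 h1 x
    · exact Set.eq_univ_iff_forall.1 h2 x

/-! ### The bound `2 (k - 1)` -/

section Bound

variable {n : ℕ} {S : Set (ZMod n)}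

theorem exists_unique_white_row {C : Set (ZMod n)}
    (h : ¬ Stalled S Set.univ C) :
    ∃ r, ∃ s ∈ S, r + s ∉ C ∧ ∀ s' ∈ S, s' ≠ s → r + s' ∈ C := by
  by_contra hcon
  push Not at hcon
  refine h ⟨fun r _ s hs hs' => ?_, fun _ _ _ _ _ => Set.mem_univ _⟩
  by_contra hw
  obtain ⟨s', h1, h2, h3⟩ := hcon r s hs hw
  exact h3 (hs' s' h1 h2)

theorem exists_unique_white_col {R : Set (ZMod n)}
    (h : ¬ Stalled S R Set.univ) :
    ∃ v, ∃ s ∈ S, v - s ∉ R ∧ ∀ s' ∈ S, s' ≠ s → v - s' ∈ R := by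
  by_contra hcon
  push Not at hcon
  refine h ⟨fun _ _ _ _ _ => Set.mem_univ _, fun r _ s hs hs' => ?_⟩
  by_contra hw
  obtain ⟨s', h1, h2, h3⟩ := hcon r s hs hw
  exact h3 (hs' s' h1 h2)

theorem ncard_sub_one_le_of_row [NeZero n] {C : Set (ZMod n)} {r s : ZMod n} (hs : s ∈ S)
    (h : ∀ s' ∈ S, s' ≠ s → r + s' ∈ C) : S.ncard - 1 ≤ C.ncard := by
  rw [← Set.ncard_sdiff_singleton_of_mem hs,
    ← Set.ncard_image_of_injective _ (add_right_injective r)]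
  refine Set.ncard_le_ncard ?_ (Set.toFinite _)
  rintro _ ⟨s', hs', rfl⟩
  exact h s' hs'.1 hs'.2

theorem ncard_sub_one_le_of_col [NeZero n] {R : Set (ZMod n)} {v s : ZMod n} (hs : s ∈ S)
    (h : ∀ s' ∈ S, s' ≠ s → v - s' ∈ R) : S.ncard - 1 ≤ R.ncard := by
  rw [← Set.ncard_sdiff_singleton_of_mem hs,
    ← Set.ncard_image_of_injective _ (sub_right_injective (b := v))]
  refine Set.ncard_le_ncard ?_ (Set.toFinite _)
  rintro _ ⟨s', hs', rfl⟩
  exact h s' hs'.1 hs'.2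

/-- With only `k - 1` black columns, the black neighbours of `r` exhaust `C`. -/
theorem subset_of_row [NeZero n] {C : Set (ZMod n)} {r s : ZMod n} (hs : s ∈ S)
    (hc : C.ncard = S.ncard - 1) (h : ∀ s' ∈ S, s' ≠ s → r + s' ∈ C) :
    ∀ v ∈ C, v - r ∈ S := by
  have : (r + ·) '' (S \ {s}) = C := by
    refine Set.eq_of_subset_of_ncard_le ?_ ?_ (Set.toFinite _)
    · rintro _ ⟨s', hs', rfl⟩
      exact h s' hs'.1 hs'.2
    · rw [Set.ncard_image_of_injective _ (add_right_injective r),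
        Set.ncard_sdiff_singleton_of_mem hs, hc]
  rw [← this]
  rintro _ ⟨s', hs', rfl⟩
  simpa using hs'.1

theorem subset_of_col [NeZero n] {R : Set (ZMod n)} {v s : ZMod n} (hs : s ∈ S)
    (hc : R.ncard = S.ncard - 1) (h : ∀ s' ∈ S, s' ≠ s → v - s' ∈ R) :
    ∀ r ∈ R, v - r ∈ S := by
  have : (v - ·) '' (S \ {s}) = R := by
    refine Set.eq_of_subset_of_ncard_le ?_ ?_ (Set.toFinite _)
    · rintro _ ⟨s', hs', rfl⟩
      exact h s' hs'.1 hs'.2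
    · rw [Set.ncard_image_of_injective _ (sub_right_injective (b := v)),
        Set.ncard_sdiff_singleton_of_mem hs, hc]
  rw [← this]
  rintro _ ⟨s', hs', rfl⟩
  simpa using hs'.1

theorem ncard_toLeft_add_ncard_toRight (B : Finset (ZMod n ⊕ ZMod n)) :
    (Sum.inl ⁻¹' (B : Set (ZMod n ⊕ ZMod n))).ncard +
      (Sum.inr ⁻¹' (B : Set (ZMod n ⊕ ZMod n))).ncard = B.card := by
  rw [← Finset.card_toLeft_add_card_toRight (u := B)]
  congr 1
  · rw [← Set.ncard_coe_finset]; congr 1; ext; simp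
  · rw [← Set.ncard_coe_finset]; congr 1; ext; simp

theorem ncard_le_card [NeZero n] (T : Set (ZMod n)) : T.ncard ≤ n := by
  simpa [Nat.card_zmod] using Set.ncard_le_card T

/-- Make all rows black as well. If the result is stalled, all columns were black at the start;
otherwise some row has `k - 1` black neighbours. -/
theorem ncard_sub_one_le_cols [NeZero n] {B : Set (ZMod n ⊕ ZMod n)}
    (hB : IsZeroForcingSet (bipGraph (circMat S)) B) :
    S.ncard - 1 ≤ (Sum.inr ⁻¹' B).ncard := by
  by_cases h : Stalled S Set.univ (Sum.inr ⁻¹' B)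
  · have := (isZeroForcingSet_bipGraph_circMat_iff.1 hB _ _ h (Set.subset_univ _) subset_rfl).2
    rw [this, Set.ncard_univ, Nat.card_zmod]
    have := ncard_le_card S
    omega
  · obtain ⟨r, s, hs, -, h'⟩ := exists_unique_white_row h
    exact ncard_sub_one_le_of_row hs h'

theorem ncard_sub_one_le_rows [NeZero n] {B : Set (ZMod n ⊕ ZMod n)}
    (hB : IsZeroForcingSet (bipGraph (circMat S)) B) :
    S.ncard - 1 ≤ (Sum.inl ⁻¹' B).ncard := by
  by_cases h : Stalled S (Sum.inl ⁻¹' B) Set.univ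
  · have := (isZeroForcingSet_bipGraph_circMat_iff.1 hB _ _ h subset_rfl (Set.subset_univ _)).1
    rw [this, Set.ncard_univ, Nat.card_zmod]
    have := ncard_le_card S
    omega
  · obtain ⟨r, s, hs, -, h'⟩ := exists_unique_white_col h
    exact ncard_sub_one_le_of_col hs h'

theorem two_mul_le_zeroForcingNumber [NeZero n] :
    2 * (S.ncard - 1) ≤ zeroForcingNumber (bipGraph (circMat S)) := by
  obtain ⟨B, hB, hz⟩ := exists_card_eq_zeroForcingNumber (bipGraph (circMat S))
  have h1 := ncard_sub_one_le_cols hz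
  have h2 := ncard_sub_one_le_rows hz
  have h3 := ncard_toLeft_add_ncard_toRight B
  omega

/-- A row, without the element `t` of its neighbourhood, and a column, without the element `s`,
form a zero forcing set, so the lower bound is attained. -/
theorem zeroForcingNumber_eq_of_forall [NeZero n] {s t v : ZMod n} (hs : s ∈ S) (ht : t ∈ S)
    (h : ∀ R C, Stalled S R C → (∀ x ∈ S, x ≠ s → v - x ∈ R) → (∀ x ∈ S, x ≠ t → x ∈ C) →
      R = Set.univ ∧ C = Set.univ) :
    zeroForcingNumber (bipGraph (circMat S)) = 2 * (S.ncard - 1) := by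
  classical
  refine le_antisymm ?_ two_mul_le_zeroForcingNumber
  set X : Set (ZMod n ⊕ ZMod n) :=
    Sum.inl '' ((v - ·) '' (S \ {s})) ∪ Sum.inr '' (S \ {t}) with hX
  have hz : IsZeroForcingSet (bipGraph (circMat S)) (X.toFinset : Set (ZMod n ⊕ ZMod n)) := by
    rw [isZeroForcingSet_bipGraph_circMat_iff]
    intro R C hRC hR hC
    refine h R C hRC (fun x hx hxs => hR ?_) fun x hx hxt => hC ?_
    · simpa [hX] using ⟨hx, hxs⟩
    · simpa [hX] using ⟨hx, hxt⟩
  refine (zeroForcingNumber_le hz).trans ?_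
  rw [← Set.ncard_eq_toFinset_card']
  refine (Set.ncard_union_le _ _).trans ?_
  rw [Set.ncard_image_of_injective _ Sum.inl_injective,
    Set.ncard_image_of_injective _ Sum.inr_injective,
    Set.ncard_image_of_injective _ (sub_right_injective (b := v)),
    Set.ncard_sdiff_singleton_of_mem hs, Set.ncard_sdiff_singleton_of_mem ht]
  omega

theorem Stalled.translate {R C : Set (ZMod n)} (h : Stalled S R C) (a : ZMod n) :
    Stalled S ((· - a) ⁻¹' R) ((· - a) ⁻¹' C) := by
  constructor
  · intro r hr s hs hs'
    have := h.1 (r - a) hr s hs fun s' h1 h2 => by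
      have := hs' s' h1 h2
      rwa [Set.mem_preimage, add_sub_right_comm] at this
    rwa [Set.mem_preimage, add_sub_right_comm]
  · intro r hr s hs hs'
    have := h.2 (r - a) hr s hs fun s' h1 h2 => by
      have := hs' s' h1 h2
      rwa [Set.mem_preimage, sub_right_comm] at this
    rwa [Set.mem_preimage, sub_right_comm]

/-- If the lower bound is attained, then the neighbourhoods of some adjacent row and column force
all vertices; by symmetry the row is `0`. -/
theorem exists_forcing_pair [NeZero n] (hk : S.ncard - 1 < n)
    (hZ : zeroForcingNumber (bipGraph (circMat S)) = 2 * (S.ncard - 1)) :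
    ∃ s₀ ∈ S, ∀ R C, Stalled S R C → (∀ s ∈ S, s₀ - s ∈ R) → S ⊆ C →
      R = Set.univ ∧ C = Set.univ := by
  obtain ⟨B, hB, hz⟩ := exists_card_eq_zeroForcingNumber (bipGraph (circMat S))
  have h1 := ncard_sub_one_le_cols hz
  have h2 := ncard_sub_one_le_rows hz
  have h3 := ncard_toLeft_add_ncard_toRight B
  have hz' := isZeroForcingSet_bipGraph_circMat_iff.1 hz
  set R₀ := Sum.inl ⁻¹' (B : Set (ZMod n ⊕ ZMod n))
  set C₀ := Sum.inr ⁻¹' (B : Set (ZMod n ⊕ ZMod n))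
  have hR₀ : R₀.ncard = S.ncard - 1 := by omega
  have hC₀ : C₀.ncard = S.ncard - 1 := by omega
  have hneR : R₀ ≠ Set.univ := fun h => by
    rw [h, Set.ncard_univ, Nat.card_zmod] at hR₀; omega
  have hneC : C₀ ≠ Set.univ := fun h => by
    rw [h, Set.ncard_univ, Nat.card_zmod] at hC₀; omega
  obtain ⟨r₁, t₁, ht₁, -, hr₁⟩ := exists_unique_white_row (C := C₀) fun h =>
    hneC (hz' _ _ h (Set.subset_univ _) subset_rfl).2
  obtain ⟨v₁, u₁, hu₁, -, hv₁⟩ := exists_unique_white_col (R := R₀) fun h =>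
    hneR (hz' _ _ h subset_rfl (Set.subset_univ _)).1
  -- A force possible at the start comes from a black vertex. Its black neighbours fill the opposite
  -- side, and it is itself adjacent to the vertex whose neighbourhood contains its own side.
  have key : ∃ r v, v - r ∈ S ∧ (∀ x ∈ C₀, x - r ∈ S) ∧ ∀ x ∈ R₀, v - x ∈ S := by
    have hns : ¬ Stalled S R₀ C₀ := fun h => hneC (hz' _ _ h subset_rfl subset_rfl).2
    simp only [Stalled, not_and_or, not_forall] at hns
    rcases hns with ⟨r, hr, t, ht, h, -⟩ | ⟨v, hv, u, hu, h, -⟩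
    · have hsub := subset_of_col hu₁ hR₀ hv₁
      exact ⟨r, v₁, hsub r hr, subset_of_row ht hC₀ h, hsub⟩
    · have hsub := subset_of_row ht₁ hC₀ hr₁
      exact ⟨r₁, v, hsub v hv, hsub, subset_of_col hu hR₀ h⟩
  obtain ⟨r, v, hrv, hC, hR⟩ := key
  refine ⟨v - r, hrv, fun R C hRC hR' hC' => ?_⟩
  obtain ⟨hu, hu'⟩ := hz' _ _ (hRC.translate r)
    (fun x hx => by
      have := hR' _ (hR x hx)
      rwa [show v - r - (v - x) = x - r by ring] at this)
    (fun x hx => hC' (hC x hx))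
  constructor
  · refine Set.eq_univ_of_forall fun x => ?_
    have : x + r ∈ (· - r) ⁻¹' R := hu ▸ Set.mem_univ _
    simpa using this
  · refine Set.eq_univ_of_forall fun x => ?_
    have : x + r ∈ (· - r) ⁻¹' C := hu' ▸ Set.mem_univ _
    simpa using this

end Bound

/-! ### The structure of extremal sets -/

section Structure

variable {G : Type*} [AddCommGroup G]

theorem exists_nsmul_of_mem_sup_zmultiples [Finite G] {H : AddSubgroup G} {x k : G}
    (hk : k ∈ H ⊔ AddSubgroup.zmultiples x) : ∃ t : ℕ, k - t • x ∈ H := by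
  obtain ⟨h, hh, z, hz, rfl⟩ := AddSubgroup.mem_sup.1 hk
  obtain ⟨t, rfl⟩ := AddSubmonoid.mem_multiples_iff _ _ |>.1 (mem_multiples_iff_mem_zmultiples.2 hz)
  exact ⟨t, by simpa using hh⟩

/-- Modulo the subgroup `H`, a set that is closed under translation by `x` except at the class
of `b` consists of an arithmetic progression ending in `b` and full cosets of `⟨x⟩`. -/
theorem exists_progression_mod [Finite G] (H : AddSubgroup G) {D : Set G} {b x : G}
    (hD : ∀ g ∈ D, ∀ h ∈ H, g + h ∈ D) (hb : b ∈ D) (hbx : b + x ∉ D)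
    (hx : ∀ g ∈ D, g - b ∉ H → g + x ∈ D) :
    ∃ l : ℕ, (∀ t, 1 ≤ t → t ≤ l + 1 → t • x ∉ H) ∧
      (∀ g, g - b ∈ H ⊔ AddSubgroup.zmultiples x → (g ∈ D ↔ ∃ t ≤ l, g - b + t • x ∈ H)) ∧
      ∀ g ∈ D, g - b ∉ H ⊔ AddSubgroup.zmultiples x →
        ∀ k ∈ H ⊔ AddSubgroup.zmultiples x, g + k ∈ D := by
  classical
  have hxK : x ∈ H ⊔ AddSubgroup.zmultiples x :=
    AddSubgroup.mem_sup_right (AddSubgroup.mem_zmultiples x)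
  have hex : ∃ t : ℕ, b - t • x ∉ D := by
    -- Going back `addOrderOf x - 1` steps from `b` leads to `b + x`.
    refine ⟨addOrderOf x - 1, ?_⟩
    have hpos := addOrderOf_pos x
    have h1 : (addOrderOf x - 1) • x + x = 0 := by
      rw [← succ_nsmul, Nat.sub_add_cancel hpos, addOrderOf_nsmul_eq_zero]
    rwa [eq_neg_of_add_eq_zero_left h1, sub_neg_eq_add]
  obtain ⟨l, hl⟩ : ∃ l, Nat.find hex = l + 1 := by
    refine Nat.exists_eq_succ_of_ne_zero fun h => ?_
    have := Nat.find_spec hex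
    rw [h, zero_nsmul, sub_zero] at this
    exact this hb
  have hlnot : b - (l + 1) • x ∉ D := hl ▸ Nat.find_spec hex
  have hlmem : ∀ t ≤ l, b - t • x ∈ D := fun t ht => by
    have := Nat.find_min hex (m := t) (by omega)
    simpa using this
  refine ⟨l, ?_, ?_, ?_⟩
  · intro t h1 h2 ht
    obtain ⟨t, rfl⟩ := Nat.exists_eq_add_of_le' h1
    have := hD _ (hlmem t (by omega)) _ ht
    rw [show b - t • x + (t + 1) • x = b + x by rw [succ_nsmul]; abel] at this
    exact hbx this
  · intro g hg
    constructor
    · intro hgD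
      have hex' : ∃ t : ℕ, g - b + t • x ∈ H := by
        obtain ⟨t, ht⟩ := exists_nsmul_of_mem_sup_zmultiples (neg_mem hg)
        exact ⟨t, by simpa [add_comm, sub_eq_add_neg] using neg_mem ht⟩
      refine ⟨Nat.find hex', ?_, Nat.find_spec hex'⟩
      -- Steps of `x` from `g` stay in `D` until `b + H` is first reached; if this took more than
      -- `l` steps, the walk would meet the coset of `b - (l + 1) • x`.
      by_contra hlt
      have hstep : ∀ j, j + (l + 1) ≤ Nat.find hex' → g + j • x ∈ D := by
        intro j
        induction j with
        | zero => intro _; simpa using hgD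
        | succ j ih =>
          intro hj
          have := hx _ (ih (by omega)) (by
            rw [add_sub_right_comm]
            exact Nat.find_min hex' (by omega))
          rwa [add_assoc, ← succ_nsmul] at this
      have h1 := hstep (Nat.find hex' - (l + 1)) (by omega)
      have h2 := hD _ h1 _ (neg_mem (Nat.find_spec hex'))
      refine hlnot ?_
      have h3 : Nat.find hex' • x = (Nat.find hex' - (l + 1)) • x + (l + 1) • x := by
        rw [← add_nsmul, Nat.sub_add_cancel (by omega)]
      rw [h3] at h2
      rwa [show g + (Nat.find hex' - (l + 1)) • x +
        -(g - b + ((Nat.find hex' - (l + 1)) • x + (l + 1) • x)) = b - (l + 1) • x by abel] at h2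
    · rintro ⟨t, ht, hH⟩
      have := hD _ (hlmem t ht) _ hH
      rwa [show b - t • x + (g - b + t • x) = g by abel] at this
  · intro g hg hgK k hk
    have hstep : ∀ j : ℕ, g + j • x ∈ D := by
      intro j
      induction j with
      | zero => simpa using hg
      | succ j ih =>
        have := hx _ ih fun hH => hgK (by
          have := sub_mem (AddSubgroup.mem_sup_left hH) (nsmul_mem hxK j)
          rwa [show g + j • x - b - j • x = g - b by abel] at this)
        rwa [add_assoc, ← succ_nsmul] at this
    obtain ⟨t, ht⟩ := exists_nsmul_of_mem_sup_zmultiples hk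
    have := hD _ (hstep t) _ ht
    rwa [show g + t • x + (k - t • x) = g + k by abel] at this

/-- If `r + s` is outside `C`, so is its whole coset, and uniqueness makes `s` alone in its coset
within `S`. A coset other than `b + H` that meets `S` lies in `S` and has several elements, so `s`
is in `b + H`. -/
theorem eq_of_forall_ne_one_coset {S : Set G} {H : AddSubgroup G} {C : Set G} {b r s : G}
    (hC : ∀ g ∈ C, ∀ h ∈ H, g + h ∈ C) (hfull : ∀ g ∈ S, g - b ∉ H → ∀ h ∈ H, g + h ∈ S)
    (hH : H ≠ ⊥) (hb : b ∈ S) (hs : s ∈ S) (hrs : r + s ∉ C)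
    (huniq : ∀ s' ∈ S, s' ≠ s → r + s' ∈ C) :
    s = b ∧ ∀ g ∈ S, g - b ∈ H → g = b := by
  have hout : ∀ h ∈ H, r + (s + h) ∉ C := fun h hh hmem => hrs (by
    have := hC _ hmem _ (neg_mem hh)
    rwa [show r + (s + h) + -h = r + s by abel] at this)
  have hall : ∀ g ∈ S, g - s ∈ H → g = s := fun g hg hgs => by
    by_contra hne
    have := hout _ hgs
    rw [add_sub_cancel] at this
    exact this (huniq g hg hne)
  have hsb : s - b ∈ H := by
    by_contra hsb
    obtain ⟨h, hh, hne⟩ := (AddSubgroup.bot_or_exists_ne_zero H).resolve_left hH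
    refine hne ?_
    have := hall (s + h) (hfull s hs hsb h hh) (by simpa using hh)
    simpa using this
  have hbs : b = s := hall b hb (by simpa using neg_mem hsb)
  subst hbs
  exact ⟨rfl, hall⟩

/-- The `l + 1` elements of `S` in the coset of `b` end at `b`; the gap starts at `b + x` and has
`addOrderOf x - (l + 1)` elements. -/
theorem compl_progression [Finite G] {S : Set G} {b x : G} {l : ℕ} (hord : l + 1 < addOrderOf x)
    (hprog : ∀ g, g - b ∈ AddSubgroup.zmultiples x →
      (g ∈ S ↔ ∃ t ≤ l, g - b + t • x ∈ (⊥ : AddSubgroup G)))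
    (hrest : ∀ g, g - b ∉ AddSubgroup.zmultiples x → g ∈ S) (g : G) :
    g ∉ S ↔ ∃ t ≤ addOrderOf x - (l + 2), g = b + x + t • x := by
  classical
  constructor
  · intro hg
    have hgx : g - b ∈ AddSubgroup.zmultiples x := by
      by_contra h; exact hg (hrest g h)
    obtain ⟨t, ht, hgt⟩ := (Finset.mem_image.1 (mem_zmultiples_iff_mem_range_addOrderOf.1 hgx))
    rw [Finset.mem_range] at ht
    rw [hprog g hgx] at hg
    push Not at hg
    have hsub : addOrderOf x - t > l := by
      by_contra hle
      refine hg (addOrderOf x - t) (by omega) ?_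
      rw [AddSubgroup.mem_bot, ← hgt, ← add_nsmul, Nat.add_sub_cancel' ht.le,
        addOrderOf_nsmul_eq_zero]
    have ht0 : t ≠ 0 := by
      rintro rfl
      exact hg 0 (by omega) (by simp [← hgt])
    refine ⟨t - 1, by omega, ?_⟩
    obtain ⟨u, rfl⟩ := Nat.exists_eq_succ_of_ne_zero ht0
    rw [← sub_eq_zero, Nat.succ_sub_one, show g - (b + x + u • x) = g - b - (u • x + x) by abel,
      ← hgt, ← succ_nsmul, sub_self]
  · rintro ⟨t, ht, rfl⟩ hmem
    rw [hprog _ (by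
      rw [show b + x + t • x - b = (t + 1) • x by rw [succ_nsmul]; abel]
      exact nsmul_mem (AddSubgroup.mem_zmultiples x) _)] at hmem
    obtain ⟨u, hu, h0⟩ := hmem
    rw [AddSubgroup.mem_bot, show b + x + t • x - b + u • x = (t + 1 + u) • x by
      rw [add_nsmul, succ_nsmul]; abel] at h0
    have := Nat.le_of_dvd (by omega) (addOrderOf_dvd_of_nsmul_eq_zero h0)
    omega

/-- A set `S` such that every proper set containing `S` can be enlarged by exactly one element of
a translate of `S` is everything, an arithmetic progression, the complement of one, or of the
third kind. -/
theorem exists_structure [Finite G] [IsAddCyclic G] {S : Set G} (hS : S.Nontrivial)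
    (hE : ∀ C, S ⊆ C → C ≠ Set.univ →
      ∃ r, ∃ s ∈ S, r + s ∉ C ∧ ∀ s' ∈ S, s' ≠ s → r + s' ∈ C) :
    S = Set.univ ∨
    (∃ (b x : G) (l : ℕ), AddSubgroup.zmultiples x = ⊤ ∧ l + 1 < addOrderOf x ∧
      ∀ g, g ∈ S ↔ ∃ t ≤ l, g = b + t • x) ∨
    (∃ (a x : G) (r : ℕ), AddSubgroup.zmultiples x ≠ ⊤ ∧ r + 1 < addOrderOf x ∧
      ∀ g, g ∉ S ↔ ∃ t ≤ r, g = a + t • x) ∨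
    (∃ (H : AddSubgroup G) (b α : G) (l : ℕ), H ≠ ⊥ ∧ 1 ≤ l ∧
      (∀ t, 1 ≤ t → t ≤ l + 1 → t • α ∉ H) ∧
      ∀ g, g ∈ S ↔ g - b ∉ H ⊔ AddSubgroup.zmultiples α ∨ g = b ∨
        ∃ t, 1 ≤ t ∧ t ≤ l ∧ g - b - t • α ∈ H) := by
  by_cases hU : S = Set.univ
  · exact Or.inl hU
  refine Or.inr ?_
  -- `C = S`: the translate `x + S` leaves `S` only at `x + b`.
  obtain ⟨x, b, hb, hbx, hx⟩ := hE S subset_rfl hU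
  rw [add_comm] at hbx
  have hx0 : x ≠ 0 := by rintro rfl; exact hbx (by simpa using hb)
  obtain ⟨l, hl, hprog, hfull⟩ := exists_progression_mod (⊥ : AddSubgroup G) (D := S) (b := b)
    (x := x) (by simp) hb hbx (fun g hg hgb => by
      rw [add_comm]; exact hx g hg fun h => hgb (by simp [h]))
  rw [bot_sup_eq] at hprog hfull
  have hord : l + 1 < addOrderOf x := by
    by_contra hcon
    exact hl (addOrderOf x) (addOrderOf_pos x) (by omega) (by simp)
  by_cases htop : AddSubgroup.zmultiples x = ⊤
  · left
    refine ⟨b - l • x, x, l, htop, hord, fun g => ?_⟩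
    rw [hprog g (htop ▸ AddSubgroup.mem_top _)]
    constructor
    · rintro ⟨t, ht, hg⟩
      refine ⟨l - t, by omega, ?_⟩
      have h1 : l • x = (l - t) • x + t • x := by rw [← add_nsmul, Nat.sub_add_cancel ht]
      rw [AddSubgroup.mem_bot] at hg
      rw [h1, ← sub_eq_zero, ← hg]; abel
    · rintro ⟨t, ht, rfl⟩
      refine ⟨l - t, by omega, ?_⟩
      have h1 : l • x = (l - t) • x + t • x := by rw [← add_nsmul, Nat.sub_add_cancel ht]
      rw [AddSubgroup.mem_bot, h1]; abel
  right
  by_cases hrest : ∀ g, g - b ∉ AddSubgroup.zmultiples x → g ∈ S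
  · left
    exact ⟨b + x, x, addOrderOf x - (l + 2), htop, by omega, compl_progression hord hprog hrest⟩
  push Not at hrest
  obtain ⟨g₁, hg₁, hg₁S⟩ := hrest
  -- `b` is alone in its coset of a nontrivial subgroup, and `S` is otherwise a union of cosets
  let Iso : AddSubgroup G → Prop := fun H => H ≠ ⊥ ∧ (∀ g ∈ S, g - b ∈ H → g = b) ∧
    ∀ g ∈ S, g ≠ b → ∀ h ∈ H, g + h ∈ S
  have hne : ({H | Iso H} : Set (AddSubgroup G)).Nonempty := by
    refine ⟨AddSubgroup.zmultiples x, fun h => hx0 (AddSubgroup.zmultiples_eq_bot.1 h), ?_⟩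
    have hCinv : ∀ g ∈ {g | ∃ s ∈ S, g - s ∈ AddSubgroup.zmultiples x},
        ∀ h ∈ AddSubgroup.zmultiples x, g + h ∈ {g | ∃ s ∈ S, g - s ∈ AddSubgroup.zmultiples x} := by
      rintro g ⟨s, hs, hgs⟩ h hh
      exact ⟨s, hs, by rw [add_sub_right_comm]; exact add_mem hgs hh⟩
    -- `C = S + ⟨x⟩`, which misses `g₁`: this isolates `b` in its coset of `⟨x⟩`.
    obtain ⟨r, s, hs, hrs, huniq⟩ := hE {g | ∃ s ∈ S, g - s ∈ AddSubgroup.zmultiples x}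
      (fun s hs => ⟨s, hs, by simp⟩) (fun h => by
        obtain ⟨s, hs, hgs⟩ : g₁ ∈ {g | ∃ s ∈ S, g - s ∈ AddSubgroup.zmultiples x} :=
          h ▸ Set.mem_univ _
        have := hfull s hs (fun hsb => hg₁ (by
          have := add_mem hgs hsb
          rwa [sub_add_sub_cancel] at this)) _ hgs
        rw [add_sub_cancel] at this
        exact hg₁S this)
    have h1 := (eq_of_forall_ne_one_coset hCinv hfull
      (fun h => hx0 (AddSubgroup.zmultiples_eq_bot.1 h)) hb hs hrs huniq).2
    exact ⟨h1, fun g hg hgb => hfull g hg fun h => hgb (h1 g hg h)⟩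
  -- Maximality is used twice below: `b` cannot be alone in its coset of the larger group `K`.
  obtain ⟨H, hHmax⟩ := (Set.toFinite {H | Iso H}).exists_maximal hne
  obtain ⟨hHbot, hHb, hHfull⟩ := hHmax.prop
  obtain ⟨s₁, hs₁, hs₁b⟩ := hS.exists_ne b
  by_cases hrest : ∀ g, g - b ∉ H → g ∈ S
  · left
    -- Writing `H = ⟨z⟩`, the complement of `S` is `b + H` without `b`, a progression of difference
    -- `z`.
    obtain ⟨z, rfl⟩ := H.isAddCyclic_iff_exists_zmultiples_eq_top.1 inferInstance
    have hz0 : z ≠ 0 := fun h => hHbot (AddSubgroup.zmultiples_eq_bot.2 h)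
    have hord' : 0 + 1 < addOrderOf z := by
      have h1 := addOrderOf_pos z
      have h2 : addOrderOf z ≠ 1 := fun h => hz0 (AddMonoid.addOrderOf_eq_one_iff.1 h)
      omega
    refine ⟨b + z, z, addOrderOf z - (0 + 2), fun h => ?_, by omega,
      compl_progression hord' (fun g hg => ?_) hrest⟩
    · exact hs₁b (hHb s₁ hs₁ (h ▸ AddSubgroup.mem_top _))
    · constructor
      · intro hgS
        exact ⟨0, le_rfl, by simp [hHb g hgS hg]⟩
      · rintro ⟨t, ht, h0⟩
        obtain rfl : t = 0 := by omega
        rw [AddSubgroup.mem_bot, zero_nsmul, add_zero, sub_eq_zero] at h0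
        rwa [h0]
  right
  push Not at hrest
  obtain ⟨g₂, hg₂, hg₂S⟩ := hrest
  have hHfull' : ∀ g ∈ S, g - b ∉ H → ∀ h ∈ H, g + h ∈ S := fun g hg hgb =>
    hHfull g hg fun h => hgb (by simp [h])
  let D : Set G := {g | ∃ s ∈ S, g - s ∈ H}
  have hSD : S ⊆ D := fun s hs => ⟨s, hs, by simp⟩
  have hDS : ∀ g ∈ D, g - b ∉ H → g ∈ S := by
    rintro g ⟨s, hs, hgs⟩ hgb
    have := hHfull' s hs (fun hsb => hgb (by
      have := add_mem hgs hsb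
      rwa [sub_add_sub_cancel] at this)) _ hgs
    rwa [add_sub_cancel] at this
  have hDinv : ∀ g ∈ D, ∀ h ∈ H, g + h ∈ D := by
    rintro g ⟨s, hs, hgs⟩ h hh
    exact ⟨s, hs, by rw [add_sub_right_comm]; exact add_mem hgs hh⟩
  -- `C = S + H`: the exceptional element is again `b`, so modulo `H` the set `D` is a progression
  -- with full cosets of `K`.
  obtain ⟨y, s, hs, hys, hy⟩ := hE D hSD fun h => hg₂S (hDS g₂ (h ▸ Set.mem_univ _) hg₂)
  obtain ⟨rfl, -⟩ := eq_of_forall_ne_one_coset hDinv hHfull' hHbot hb hs hys hy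
  rw [add_comm] at hys
  have hyH : y ∉ H := fun h => hys (hDinv _ (hSD hb) _ h)
  obtain ⟨m, hm, hprogm, hfullm⟩ := exists_progression_mod H hDinv (hSD hb) hys
    fun g hg hgb => by
      rw [add_comm]
      exact hy g (hDS g hg hgb) fun h => hgb (by simp [h])
  set K := H ⊔ AddSubgroup.zmultiples y with hK
  have hyK : y ∈ K := AddSubgroup.mem_sup_right (AddSubgroup.mem_zmultiples y)
  have hHK : H ≤ K := le_sup_left
  have hfullK : ∀ g ∈ S, g - s ∉ K → ∀ k ∈ K, g + k ∈ S := fun g hg hgK k hk =>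
    hDS _ (hfullm g (hSD hg) hgK k hk) fun h => hgK (by
      have := sub_mem (hHK h) hk
      rwa [show g + k - s - k = g - s by abel] at this)
  have hKbot : K ≠ ⊥ := fun h => hHbot (le_bot_iff.1 (h ▸ hHK))
  have hnotIso : ¬ ∀ g ∈ S, g - s ∈ K → g = s := fun h => by
    have hIso : Iso K := ⟨hKbot, h, fun g hg hgs => hfullK g hg fun hgK => hgs (h g hg hgK)⟩
    exact hyH (hHmax.le_of_ge hIso hHK hyK)
  have hm1 : 1 ≤ m := by
    by_contra hm0
    obtain rfl : m = 0 := by omega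
    refine hnotIso fun g hg hgK => hHb g hg ?_
    obtain ⟨t, ht, h⟩ := (hprogm g hgK).1 (hSD hg)
    obtain rfl : t = 0 := by omega
    simpa using h
  have hSK : ∀ g, g - s ∉ K → g ∈ S := by
    by_contra hcon
    push Not at hcon
    obtain ⟨g₃, hg₃, hg₃S⟩ := hcon
    -- `C = S + K`: were it proper, the exceptional element would be alone in its coset of `K`.
    obtain ⟨r, u, hu, hru, huniq⟩ := hE {g | ∃ s ∈ S, g - s ∈ K}
      (fun s hs => ⟨s, hs, by simp⟩) (fun h => by
        obtain ⟨u, hu, hgu⟩ : g₃ ∈ {g | ∃ s ∈ S, g - s ∈ K} := h ▸ Set.mem_univ _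
        have := hfullK u hu (fun hsb => hg₃ (by
          have := add_mem hgu hsb
          rwa [sub_add_sub_cancel] at this)) _ hgu
        rw [add_sub_cancel] at this
        exact hg₃S this)
    refine hnotIso (eq_of_forall_ne_one_coset ?_ hfullK hKbot hb hu hru huniq).2
    rintro g ⟨s, hs, hgs⟩ h hh
    exact ⟨s, hs, by rw [add_sub_right_comm]; exact add_mem hgs hh⟩
  -- The progression found ends at the exceptional element; with the opposite difference it starts
  -- there.
  have hneg : H ⊔ AddSubgroup.zmultiples (-y) = K := by rw [AddSubgroup.zmultiples_neg]
  refine ⟨H, s, -y, m, hHbot, hm1, fun t h1 h2 h => hm t h1 h2 (by simpa using neg_mem h),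
    fun g => ?_⟩
  rw [hneg]
  simp only [smul_neg, sub_neg_eq_add]
  constructor
  · intro hg
    by_cases hgK : g - s ∈ K
    · obtain ⟨t, ht, h⟩ := (hprogm g hgK).1 (hSD hg)
      rcases Nat.eq_zero_or_pos t with rfl | hpos
      · exact Or.inr (Or.inl (hHb g hg (by simpa using h)))
      · exact Or.inr (Or.inr ⟨t, hpos, ht, h⟩)
    · exact Or.inl hgK
  · rintro (h | rfl | ⟨t, h1, h2, h⟩)
    · exact hSK g h
    · exact hb
    · have hgK : g - s ∈ K := by
        have := sub_mem (hHK h) (nsmul_mem hyK t)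
        rwa [add_sub_cancel_right] at this
      refine hDS g ((hprogm g hgK).2 ⟨t, h2, h⟩) fun hgH => hm t h1 (by omega) ?_
      have := sub_mem h hgH
      rwa [add_sub_cancel_left] at this

end Structure

/-! ### A bound on the number of cosets in family 3 -/

section Forcing

variable {n : ℕ} {S : Set (ZMod n)} {H : AddSubgroup (ZMod n)} {b : ZMod n}

theorem stalled_of_union_cosets (hH : H ≠ ⊥) (hfull : ∀ g ∈ S, g ≠ b → ∀ h ∈ H, g + h ∈ S)
    {Y : Set (ZMod n)} (hY : ∀ g ∈ Y, ∀ h ∈ H, g + h ∈ Y) :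
    Stalled S Y {v | v - b ∈ Y} := by
  obtain ⟨h, hh, h0⟩ := (AddSubgroup.bot_or_exists_ne_zero H).resolve_left hH
  constructor
  · intro r hr s hs huniq
    by_cases hsb : s = b
    · simpa [hsb] using hr
    · have h1 : r + (s + h) - b ∈ Y := huniq (s + h) (hfull s hs hsb h hh) (by simpa using h0)
      have h2 := hY _ h1 _ (neg_mem hh)
      rw [show r + (s + h) - b + -h = r + s - b by ring] at h2
      exact h2
  · intro v hv s hs huniq
    by_cases hsb : s = b
    · simpa [hsb] using hv
    · have h1 := huniq (s + h) (hfull s hs hsb h hh) (by simpa using h0)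
      have h2 := hY _ h1 _ hh
      rwa [show v - (s + h) + h = v - s by ring] at h2

theorem exists_nsmul_mem_of_forcing {α s₀ : ZMod n} {l : ℕ} (hH : H ≠ ⊥)
    (hS : ∀ g, g ∈ S ↔ g = b ∨ ∃ t, 1 ≤ t ∧ t ≤ l ∧ g - b - t • α ∈ H) (hl : 1 ≤ l)
    (hs₀ : s₀ ∈ S) (hforce : ∀ R C, Stalled S R C → (∀ s ∈ S, s₀ - s ∈ R) → S ⊆ C →
      R = Set.univ ∧ C = Set.univ) :
    ∃ t, 1 ≤ t ∧ t ≤ 2 * l ∧ t • α ∈ H := by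
  by_contra! hα
  have hfull : ∀ g ∈ S, g ≠ b → ∀ h ∈ H, g + h ∈ S := by
    intro g hg hgb h hh
    obtain ⟨t, h1, h2, h3⟩ := ((hS g).1 hg).resolve_left hgb
    refine (hS _).2 (Or.inr ⟨t, h1, h2, ?_⟩)
    rw [show g + h - b - t • α = g - b - t • α + h by ring]
    exact add_mem h3 hh
  have hb : b ∈ S := (hS b).2 (Or.inl rfl)
  have hbH : ∀ h ∈ H, h ≠ 0 → b + h ∉ S := by
    intro h hh h0 hmem
    obtain ⟨t, h1, h2, h3⟩ := ((hS _).1 hmem).resolve_left (by simpa using h0)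
    refine hα t h1 (by omega) ?_
    have := sub_mem hh h3
    rwa [show h - (b + h - b - t • α) = t • α by ring] at this
  rcases (hS s₀).1 hs₀ with rfl | ⟨a, ha1, hal, ha⟩
  -- Here `s₀ = b`, and the two neighbourhoods are already stalled: `S` meets its reflection in `b`
  -- only in `b`, so a black row `b - u` with `u ≠ b` has the white neighbours `b - u + b` and `b +
  -- h`. Columns are symmetric.
  · have hrefl : ∀ s ∈ S, s ≠ s₀ → s₀ + (s₀ - s) ∉ S := by
      intro s hs hne hmem
      obtain ⟨t, h1, h2, h3⟩ := ((hS s).1 hs).resolve_left hne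
      obtain ⟨u, h4, h5, h6⟩ := ((hS _).1 hmem).resolve_left fun h => hne (by
        simpa [sub_eq_zero, eq_comm] using h)
      refine hα (t + u) (by omega) (by omega) ?_
      have := neg_mem (add_mem h3 h6)
      rwa [show -(s - s₀ - t • α + (s₀ + (s₀ - s) - s₀ - u • α)) = (t + u) • α by
        rw [add_nsmul]; ring] at this
    obtain ⟨h, hh, h0⟩ := (AddSubgroup.bot_or_exists_ne_zero H).resolve_left hH
    have hcov : ∀ u ∈ S, u ≠ s₀ → ∀ s ∈ S, (∀ s' ∈ S, s' ≠ s → s₀ - u + s' ∈ S) → False := by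
      intro u hu hne s hs huniq
      have hsb : s₀ = s := by
        by_contra hns
        have := huniq s₀ hb hns
        rw [add_comm] at this
        exact hrefl u hu hne this
      have huh : u + h ≠ s := by
        intro he
        obtain ⟨t, h1, h2, h3⟩ := ((hS u).1 hu).resolve_left hne
        refine hα t h1 (by omega) ?_
        have := neg_mem (add_mem h3 hh)
        rwa [show -(u - s₀ - t • α + h) = t • α by
          rw [hsb, ← he]; ring] at this
      have := huniq (u + h) (hfull u hu hne h hh) huh
      rw [show s₀ - u + (u + h) = s₀ + h by ring] at this
      exact hbH h hh h0 this
    have hst : Stalled S {r | s₀ - r ∈ S} S := by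
      constructor
      · intro r hr s hs huniq
        by_cases hrs : s₀ - r = s₀
        · obtain rfl : r = 0 := by simpa using hrs
          simpa using hs
        · exact (hcov _ hr hrs s hs (by simpa using huniq)).elim
      · intro v hv s hs huniq
        by_cases hvs : v = s₀
        · subst hvs
          simpa using hs
        · refine (hcov v hv hvs s hs fun s' hs' hne => ?_).elim
          have : s₀ - (v - s') ∈ S := huniq s' hs' hne
          rwa [show s₀ - (v - s') = s₀ - v + s' by ring] at this
    have hu := (hforce _ _ hst (fun s hs => by simpa using hs) subset_rfl).2
    exact hbH h hh h0 (hu ▸ Set.mem_univ _)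
  -- Index classes by multiples of `α`: the columns `S - b` have indices `0, …, l` and the rows `s₀
  -- - S` have indices `a - l, …, a`, all within `a - l, …, l`.
  · set Y : Set (ZMod n) := {g | ∃ j : ℤ, a - l ≤ j ∧ j ≤ l ∧ g - j • α ∈ H} with hYdef
    have hst := stalled_of_union_cosets hH hfull (Y := Y) (by
      rintro g ⟨j, h1, h2, h3⟩ h hh
      exact ⟨j, h1, h2, by rw [add_sub_right_comm]; exact add_mem h3 hh⟩)
    have hu := (hforce _ _ hst ?_ ?_).1
    -- Here `l + 1 - j` lies between `1` and `2 * l + 1 - a ≤ 2 * l`, because `a ≥ 1`.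
    · obtain ⟨j, h1, h2, h3⟩ : (l + 1) • α ∈ Y := hu ▸ Set.mem_univ _
      obtain ⟨i, hi⟩ := Int.eq_ofNat_of_zero_le (show 0 ≤ l + 1 - j by omega)
      refine hα i (by omega) (by omega) ?_
      rw [← natCast_zsmul, ← hi, sub_zsmul]
      simpa [add_zsmul, add_nsmul, sub_eq_add_neg] using h3
    · intro s hs
      rcases (hS s).1 hs with rfl | ⟨t, h1, h2, h3⟩
      · exact ⟨a, by omega, by omega, by simpa using ha⟩
      · refine ⟨a - t, by omega, by omega, ?_⟩
        have := sub_mem ha h3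
        rwa [show s₀ - b - a • α - (s - b - t • α) = s₀ - s - ((a : ℤ) - t) • α by
          rw [sub_zsmul, natCast_zsmul, natCast_zsmul]; ring] at this
    · intro s hs
      rcases (hS s).1 hs with rfl | ⟨t, h1, h2, h3⟩
      · exact ⟨0, by omega, by omega, by simp⟩
      · exact ⟨t, by omega, by omega, by simpa using h3⟩

/-! ### Sets whose circulants attain the bound -/

/-- Start with rows and columns `0, …, k - 2`. From `j = k - 1` on, row `j - (k - 1)` forces column
`j`, which then forces row `j`. -/
theorem zeroForcingNumber_interval [NeZero n] {k : ℕ} (hk : 2 ≤ k) (hkn : k ≤ n)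
    (hS : ∀ g, g ∈ S ↔ ∃ t < k, g = (t : ZMod n)) :
    zeroForcingNumber (bipGraph (circMat S)) = 2 * (S.ncard - 1) := by
  refine zeroForcingNumber_eq_of_forall (s := 0) (t := ((k - 1 : ℕ) : ZMod n))
    (v := ((k - 1 : ℕ) : ZMod n)) ((hS _).2 ⟨0, by omega, by simp⟩)
    ((hS _).2 ⟨k - 1, by omega, rfl⟩) fun R C hRC hR hC => ?_
  have hinj : ∀ i j : ℕ, i < n → j < n → (i : ZMod n) = j → i = j := fun i j hi hj h => by
    have := congrArg ZMod.val h
    rwa [ZMod.val_natCast_of_lt hi, ZMod.val_natCast_of_lt hj] at this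
  have key : ∀ j : ℕ, (j : ZMod n) ∈ R ∧ (j : ZMod n) ∈ C := by
    intro j
    induction j using Nat.strong_induction_on with
    | _ j ih =>
      by_cases hj : j < k - 1
      · have h1 := hR ((k - 1 - j : ℕ) : ZMod n) ((hS _).2 ⟨k - 1 - j, by omega, rfl⟩) fun h => by
          have := hinj (k - 1 - j) 0 (by omega) (by omega) (by simpa using h)
          omega
        have h2 := hC (j : ZMod n) ((hS _).2 ⟨j, by omega, rfl⟩) fun h => by
          have := hinj _ _ (by omega) (by omega) h
          omega
        refine ⟨?_, h2⟩
        rwa [← Nat.cast_sub (by omega), show k - 1 - (k - 1 - j) = j by omega] at h1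
      · have hC' : (j : ZMod n) ∈ C := by
          have := hRC.1 ((j - (k - 1) : ℕ) : ZMod n) (ih _ (by omega)).1 ((k - 1 : ℕ) : ZMod n)
            ((hS _).2 ⟨k - 1, by omega, rfl⟩) fun s' hs' hne => by
              obtain ⟨t, ht, rfl⟩ := (hS _).1 hs'
              have : t ≠ k - 1 := fun h => hne (by rw [h])
              rw [← Nat.cast_add]
              exact (ih _ (by omega)).2
          rwa [← Nat.cast_add, Nat.sub_add_cancel (by omega)] at this
        refine ⟨?_, hC'⟩
        have := hRC.2 _ hC' 0 ((hS _).2 ⟨0, by omega, by simp⟩) fun s' hs' hne => by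
          obtain ⟨t, ht, rfl⟩ := (hS _).1 hs'
          have : t ≠ 0 := fun h => hne (by simp [h])
          rw [← Nat.cast_sub (by omega)]
          exact (ih _ (by omega)).1
        simpa using this
  constructor
  · exact Set.eq_univ_of_forall fun x => by simpa using (key x.val).1
  · exact Set.eq_univ_of_forall fun x => by simpa using (key x.val).2

/-- If the rows in `L` suffice to fill the columns, and the column `v` is adjacent to all rows in
`L` (other than the removed one), then the columns in `v - L` fill the rows. -/
theorem zeroForcingNumber_eq_of_fill [NeZero n] {L : Set (ZMod n)} {t v : ZMod n} (ht : t ∈ S)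
    (hL : ∀ r ∈ L, v - r ∈ S ∧ v - r ≠ t)
    (hfill : ∀ C : Set (ZMod n), (∀ x ∈ S, x ≠ t → x ∈ C) →
      (∀ r ∈ L, ∀ s ∈ S, (∀ s' ∈ S, s' ≠ s → r + s' ∈ C) → r + s ∈ C) → C = Set.univ) :
    zeroForcingNumber (bipGraph (circMat S)) = 2 * (S.ncard - 1) := by
  -- The reflection `g ↦ v - g` exchanges rows and columns, so one filling argument serves both
  -- sides.
  refine zeroForcingNumber_eq_of_forall ht ht (v := v) fun R C hRC hR hC => ⟨?_, ?_⟩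
  · have := hfill {g | v - g ∈ R} hR fun r hr s hs huniq => by
      have := hRC.2 (v - r) (hC _ (hL r hr).1 (hL r hr).2) s hs fun s' h1 h2 => by
        rw [sub_sub]; exact huniq s' h1 h2
      rwa [sub_sub] at this
    refine Set.eq_univ_of_forall fun x => ?_
    have hx : v - x ∈ {g | v - g ∈ R} := this ▸ Set.mem_univ _
    simpa using hx
  · refine hfill C hC fun r hr => hRC.1 r ?_
    have := hR _ (hL r hr).1 (hL r hr).2
    rwa [sub_sub_cancel] at this

theorem nsmul_eq_nsmul_of_lt {x : ZMod n} {i j : ℕ} (hi : i < addOrderOf x)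
    (hj : j < addOrderOf x) (h : i • x = j • x) : i = j :=
  nsmul_injOn_Iio_addOrderOf hi hj h

/-- With `a + (r + 1) • x` removed, the white columns are `a + t • x` for `t ≤ r + 1`. Row `-(i •
x)` forces the one of index `r + 1 - i`: those of larger index are already black, those of smaller
index lie in the gap of its neighbourhood. The shift by `w ∉ ⟨x⟩` makes all rows in `⟨x⟩` black at
the start. -/
theorem zeroForcingNumber_compl_progression [NeZero n] {a x : ZMod n} {r : ℕ}
    (hx : AddSubgroup.zmultiples x ≠ ⊤) (hr : r + 1 < addOrderOf x)
    (hS : ∀ g, g ∉ S ↔ ∃ t ≤ r, g = a + t • x) :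
    zeroForcingNumber (bipGraph (circMat S)) = 2 * (S.ncard - 1) := by
  have ht : a + (r + 1) • x ∈ S := by
    by_contra h
    obtain ⟨t, h1, h2⟩ := (hS _).1 h
    have := nsmul_eq_nsmul_of_lt hr (by omega) (add_left_cancel h2)
    omega
  obtain ⟨w, hw⟩ : ∃ w, w ∉ AddSubgroup.zmultiples x := by
    by_contra! h
    exact hx ((AddSubgroup.eq_top_iff' _).2 h)
  refine zeroForcingNumber_eq_of_fill (L := AddSubgroup.zmultiples x) (v := a + w) ht ?_ ?_
  · have hne : ∀ ρ ∈ AddSubgroup.zmultiples x, ∀ t : ℕ, a + w - ρ ≠ a + t • x := by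
      intro ρ hρ t h
      apply hw
      have := add_mem (nsmul_mem (AddSubgroup.mem_zmultiples x) t) hρ
      rwa [show t • x + ρ = w by linear_combination -h] at this
    refine fun ρ hρ => ⟨?_, hne ρ hρ _⟩
    by_contra h
    obtain ⟨t, -, h2⟩ := (hS _).1 h
    exact hne ρ hρ t h2
  · intro C hC hrow
    have key : ∀ i ≤ r + 1, a + (r + 1 - i) • x ∈ C := by
      intro i
      induction i using Nat.strong_induction_on with
      | _ i ih =>
        intro hi
        have hsum : (r + 1) • x = (r + 1 - i) • x + i • x := by
          rw [← add_nsmul, Nat.sub_add_cancel hi]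
        have := hrow (-(i • x)) (neg_mem (nsmul_mem (AddSubgroup.mem_zmultiples x) i))
          (a + (r + 1) • x) ht fun s' hs' hne => by
            by_contra hcon
            have hw : ∃ t ≤ r + 1, -(i • x) + s' = a + t • x := by
              by_cases he : -(i • x) + s' = a + (r + 1) • x
              · exact ⟨r + 1, le_rfl, he⟩
              · have : -(i • x) + s' ∉ S := fun h => hcon (hC _ h he)
                obtain ⟨t, h1, h2⟩ := (hS _).1 this
                exact ⟨t, by omega, h2⟩
            obtain ⟨t, h1, h2⟩ := hw
            have hs'eq : s' = a + (t + i) • x := by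
              rw [add_nsmul]; linear_combination h2
            rcases lt_trichotomy (t + i) (r + 1) with hlt | heq | hgt
            · exact (hS s').2 ⟨t + i, by omega, hs'eq⟩ hs'
            · exact hne (by rw [hs'eq, heq])
            · have := ih (r + 1 - t) (by omega) (by omega)
              rw [show r + 1 - (r + 1 - t) = t by omega, ← h2] at this
              exact hcon this
        rwa [hsum, show -(i • x) + (a + ((r + 1 - i) • x + i • x)) = a + (r + 1 - i) • x by
          ring] at this
    refine Set.eq_univ_of_forall fun g => ?_
    by_cases hg : g ∈ S
    · by_cases he : g = a + (r + 1) • x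
      · have := key 0 (by omega)
        rwa [Nat.sub_zero, ← he] at this
      · exact hC g hg he
    · obtain ⟨t, h1, rfl⟩ := (hS _).1 hg
      have := key (r + 1 - t) (by omega)
      rwa [show r + 1 - (r + 1 - t) = t by omega] at this

/-- A column `g` in the class of `β - j • α` is forced by row `g - β`. The other neighbours of this
row lie outside the big coset of `β` or have class index `t - j` with `1 ≤ t ≤ l`: positive indices
belong to `S`, the others were filled earlier, and index `0` counts as filled since `t ≥ 1`. -/
theorem fill_classes {β α : ZMod n} {l N : ℕ} (hα : ∀ t, 1 ≤ t → t ≤ l → t • α ∉ H)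
    (hS : ∀ g, g ∈ S ↔ g - β ∉ H ⊔ AddSubgroup.zmultiples α ∨ g = β ∨
      ∃ t, 1 ≤ t ∧ t ≤ l ∧ g - β - t • α ∈ H)
    {C : Set (ZMod n)} (hC : ∀ x ∈ S, x ≠ β → x ∈ C)
    (hrow : ∀ r, (∃ i < N, r + i • α ∈ H) →
      ∀ s ∈ S, (∀ s' ∈ S, s' ≠ s → r + s' ∈ C) → r + s ∈ C) :
    ∀ j < N, ∀ g, g - β + j • α ∈ H → g ∈ C := by
  intro j
  induction j using Nat.strong_induction_on with
  | _ j ih =>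
    intro hj g hg
    have hαK : α ∈ H ⊔ AddSubgroup.zmultiples α :=
      AddSubgroup.mem_sup_right (AddSubgroup.mem_zmultiples α)
    have hgK : g - β ∈ H ⊔ AddSubgroup.zmultiples α := by
      have := sub_mem (AddSubgroup.mem_sup_left hg) (nsmul_mem hαK j)
      rwa [add_sub_cancel_right] at this
    have := hrow (g - β) ⟨j, hj, hg⟩ β ((hS β).2 (Or.inr (Or.inl rfl))) fun s' hs' hne => by
      rcases (hS s').1 hs' with h | h | ⟨t, h1, h2, h3⟩
      · have hout : g - β + s' - β ∉ H ⊔ AddSubgroup.zmultiples α := fun hmem => h (by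
          have := sub_mem hmem hgK
          rwa [show g - β + s' - β - (g - β) = s' - β by ring] at this)
        refine hC _ ((hS _).2 (Or.inl hout)) fun he => hout ?_
        rw [he, sub_self]; exact zero_mem _
      · exact (hne h).elim
      · have hsum := add_mem hg h3
        rcases Nat.lt_or_ge j t with hlt | hge
        · obtain ⟨u, rfl⟩ := Nat.exists_eq_add_of_lt hlt
          have hmem : g - β + s' - β - (u + 1) • α ∈ H := by
            rwa [show g - β + j • α + (s' - β - (j + u + 1) • α) =
              g - β + s' - β - (u + 1) • α by
                simp only [add_nsmul]; ring] at hsum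
          refine hC _ ((hS _).2 (Or.inr (Or.inr ⟨u + 1, by omega, by omega, hmem⟩))) fun he => ?_
          rw [he, sub_self, zero_sub] at hmem
          exact hα (u + 1) (by omega) (by omega) (by simpa using neg_mem hmem)
        · obtain ⟨u, rfl⟩ := Nat.exists_eq_add_of_le hge
          refine ih u (by omega) (by omega) _ ?_
          rwa [show g - β + (t + u) • α + (s' - β - t • α) = g - β + s' - β + u • α by
            rw [add_nsmul]; ring] at hsum
    rwa [sub_add_cancel] at this

theorem zeroForcingNumber_classes_of_ne_top [NeZero n] {β α : ZMod n} {l : ℕ}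
    (hα : ∀ t, 1 ≤ t → t ≤ l → t • α ∉ H) (hK : H ⊔ AddSubgroup.zmultiples α ≠ ⊤)
    (hS : ∀ g, g ∈ S ↔ g - β ∉ H ⊔ AddSubgroup.zmultiples α ∨ g = β ∨
      ∃ t, 1 ≤ t ∧ t ≤ l ∧ g - β - t • α ∈ H) :
    zeroForcingNumber (bipGraph (circMat S)) = 2 * (S.ncard - 1) := by
  obtain ⟨w, hw⟩ : ∃ w, w ∉ H ⊔ AddSubgroup.zmultiples α := by
    by_contra! h
    exact hK ((AddSubgroup.eq_top_iff' _).2 h)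
  have hαK : α ∈ H ⊔ AddSubgroup.zmultiples α :=
    AddSubgroup.mem_sup_right (AddSubgroup.mem_zmultiples α)
  refine zeroForcingNumber_eq_of_fill (L := (H ⊔ AddSubgroup.zmultiples α : AddSubgroup (ZMod n)))
    (v := β + w) ((hS β).2 (Or.inr (Or.inl rfl))) ?_ ?_
  · intro ρ hρ
    have hout : β + w - ρ - β ∉ H ⊔ AddSubgroup.zmultiples α := fun h => hw (by
      have := add_mem h hρ
      rwa [show β + w - ρ - β + ρ = w by ring] at this)
    refine ⟨(hS _).2 (Or.inl hout), fun he => hout ?_⟩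
    rw [he, sub_self]; exact zero_mem _
  · intro C hC hrow
    refine Set.eq_univ_of_forall fun g => ?_
    by_cases hg : g - β ∈ H ⊔ AddSubgroup.zmultiples α
    · obtain ⟨j, hj⟩ := exists_nsmul_of_mem_sup_zmultiples (neg_mem hg)
      refine fill_classes hα hS hC (N := j + 1) (fun r ⟨i, hi, hr⟩ => hrow r ?_) j (by omega) g ?_
      · have := sub_mem (AddSubgroup.mem_sup_left hr) (nsmul_mem hαK i)
        rwa [add_sub_cancel_right] at this
      · have := neg_mem hj
        rwa [show -(-(g - β) - j • α) = g - β + j • α by ring] at this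
    · refine hC g ((hS g).2 (Or.inl hg)) fun he => hg ?_
      rw [he, sub_self]; exact zero_mem _

/-- The rows available through the column `β + α` fill the classes of index `0, -1, …, -(l - 1)`
relative to `β`, and `S` supplies the indices `1, …, l`. These `2 * l` consecutive classes are
everything because `q ≤ 2 * l`. -/
theorem zeroForcingNumber_classes_of_eq_top [NeZero n] {β α : ZMod n} {l q : ℕ} (hl : 1 ≤ l)
    (hα : ∀ t, 1 ≤ t → t ≤ l → t • α ∉ H) (hK : H ⊔ AddSubgroup.zmultiples α = ⊤)
    (hq : 1 ≤ q) (hql : q ≤ 2 * l) (hqα : q • α ∈ H)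
    (hS : ∀ g, g ∈ S ↔ g - β ∉ H ⊔ AddSubgroup.zmultiples α ∨ g = β ∨
      ∃ t, 1 ≤ t ∧ t ≤ l ∧ g - β - t • α ∈ H) :
    zeroForcingNumber (bipGraph (circMat S)) = 2 * (S.ncard - 1) := by
  refine zeroForcingNumber_eq_of_fill (L := {r | ∃ i < l, r + i • α ∈ H})
    (v := β + α) ((hS β).2 (Or.inr (Or.inl rfl))) ?_ ?_
  · rintro ρ ⟨i, hi, hρ⟩
    have hmem : β + α - ρ - β - (i + 1) • α ∈ H := by
      have := neg_mem hρ
      rwa [show -(ρ + i • α) = β + α - ρ - β - (i + 1) • α by rw [succ_nsmul]; ring] at this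
    refine ⟨(hS _).2 (Or.inr (Or.inr ⟨i + 1, by omega, by omega, hmem⟩)), fun he => ?_⟩
    rw [he, sub_self, zero_sub] at hmem
    exact hα (i + 1) (by omega) (by omega) (by simpa using neg_mem hmem)
  · intro C hC hrow
    have hfill := fill_classes hα hS hC hrow
    refine Set.eq_univ_of_forall fun g => ?_
    obtain ⟨j, hj⟩ := exists_nsmul_of_mem_sup_zmultiples (H := H) (x := α) (k := -(g - β))
      (hK ▸ AddSubgroup.mem_top _)
    have hj' : g - β + (j % q) • α ∈ H := by
      have h1 := sub_mem (neg_mem hj) (nsmul_mem hqα (j / q))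
      have h2 : j • α = (j % q) • α + (j / q) • q • α := by
        rw [← mul_nsmul, ← add_nsmul, Nat.mod_add_div]
      rw [h2] at h1
      rwa [show -(-(g - β) - ((j % q) • α + (j / q) • q • α)) - (j / q) • q • α =
        g - β + (j % q) • α by ring] at h1
    have hlt := Nat.mod_lt j hq
    by_cases hjl : j % q < l
    · exact hfill _ hjl g hj'
    · by_cases he : g = β
      · exact hfill 0 (by omega) g (by simp [he])
      · refine hC g ((hS g).2 (Or.inr (Or.inr ⟨q - j % q, by omega, by omega, ?_⟩))) he
        have h1 := sub_mem hj' hqα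
        have h2 : q • α = (q - j % q) • α + (j % q) • α := by
          rw [← add_nsmul, Nat.sub_add_cancel hlt.le]
        rwa [h2, show g - β + (j % q) • α - ((q - j % q) • α + (j % q) • α) =
          g - β - (q - j % q) • α by ring] at h1

end Forcing

/-! ### The matrices of the three families -/

section Families

variable {n : ℕ}

theorem P_pow_eq_circMat [NeZero n] (x : ℕ) : P n ^ x = circMat {(x : ZMod n)} := by
  induction x with
  | zero =>
    ext i j
    simp [circMat, Matrix.one_apply, sub_eq_zero, eq_comm]
  | succ x ih =>
    rw [pow_succ, ih]
    ext i j
    rw [Matrix.mul_apply, Finset.sum_eq_single (j - 1)]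
    · simp [circMat, P, sub_eq_iff_eq_add, add_assoc, add_comm]
    · intro m _ hm
      have : ¬ j = m + 1 := fun h => hm (by rw [h]; ring)
      simp [P, this]
    · simp

theorem circMat_sum {ι : Type*} (s : Finset ι) (A : ι → Set (ZMod n))
    (h : ∀ i ∈ s, ∀ j ∈ s, ∀ g, g ∈ A i → g ∈ A j → i = j) :
    ∑ i ∈ s, circMat (A i) = circMat {g | ∃ i ∈ s, g ∈ A i} := by
  classical
  ext i j
  rw [Matrix.sum_apply]
  by_cases hex : ∃ a ∈ s, j - i ∈ A a
  · obtain ⟨a, ha, hja⟩ := hex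
    rw [Finset.sum_eq_single_of_mem a ha]
    · rw [circMat_eq_one.2 hja, circMat_eq_one.2 (show j - i ∈ {g | ∃ i ∈ s, g ∈ A i} from ⟨a, ha, hja⟩)]
    · intro b hb hne
      have : j - i ∉ A b := fun hjb => hne (h b hb a ha _ hjb hja)
      simp [circMat, this]
  · have h1 : ∀ a ∈ s, circMat (A a) i j = 0 := fun a ha => by
      have : j - i ∉ A a := fun h => hex ⟨a, ha, h⟩
      simp [circMat, this]
    rw [Finset.sum_eq_zero h1]
    simp only [circMat, Matrix.of_apply, Set.mem_ofPred_eq, hex, if_false]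

theorem circMat_add {A B : Set (ZMod n)} (h : Disjoint A B) :
    circMat A + circMat B = circMat (A ∪ B) := by
  ext i j
  have := fun hA : j - i ∈ A => Set.disjoint_left.1 h hA
  by_cases hA : j - i ∈ A <;> by_cases hB : j - i ∈ B <;> simp_all [circMat]

theorem J_sub_circMat (A : Set (ZMod n)) : J n - circMat A = circMat Aᶜ := by
  ext i j
  by_cases hA : j - i ∈ A <;> simp [circMat, J, hA]

theorem sum_P_pow_eq_circMat [NeZero n] {k : ℕ} (hk : k ≤ n) :
    ∑ t ∈ Finset.range k, P n ^ t = circMat {g | ∃ t < k, g = (t : ZMod n)} := by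
  simp only [P_pow_eq_circMat]
  rw [circMat_sum]
  · simp
  · intro i hi j hj g h1 h2
    rw [Finset.mem_range] at hi hj
    have := congrArg ZMod.val (h1.symm.trans h2)
    rwa [ZMod.val_natCast_of_lt (by omega), ZMod.val_natCast_of_lt (by omega)] at this

theorem J_sub_sum_P_pow_eq_circMat [NeZero n] {a r i : ℕ} (hr : r + 1 ≤ addOrderOf (i : ZMod n)) :
    J n - ∑ t ∈ Finset.range (r + 1), P n ^ (a + t * i) =
      circMat {g | ∃ t ≤ r, g = (a : ZMod n) + t • (i : ZMod n)}ᶜ := by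
  simp only [P_pow_eq_circMat]
  rw [circMat_sum, J_sub_circMat]
  · simp
  · intro t ht u hu g h1 h2
    rw [Finset.mem_range] at ht hu
    rw [Set.mem_singleton_iff] at h1 h2
    rw [h1] at h2
    push_cast at h2
    refine nsmul_eq_nsmul_of_lt (x := (i : ZMod n)) (by omega) (by omega) ?_
    simpa using h2

/-! ### Residue classes as cosets in `ZMod n` -/

theorem intCast_mem_zmultiples_iff {d : ℕ} (hd : d ∣ n) (m : ℤ) :
    (m : ZMod n) ∈ AddSubgroup.zmultiples (d : ZMod n) ↔ (d : ℤ) ∣ m := by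
  rw [AddSubgroup.mem_zmultiples_iff]
  constructor
  · rintro ⟨z, hz⟩
    have h1 : ((z * d : ℤ) : ZMod n) = (m : ZMod n) := by simpa using hz
    rw [ZMod.intCast_eq_intCast_iff_dvd_sub] at h1
    have h2 := (Int.natCast_dvd_natCast.2 hd).trans h1
    simpa using dvd_add h2 (Dvd.intro_left z rfl)
  · rintro ⟨z, rfl⟩
    exact ⟨z, by simp [mul_comm]⟩

theorem zmultiples_sup_zmultiples_natCast (d α : ℕ) :
    AddSubgroup.zmultiples (d : ZMod n) ⊔ AddSubgroup.zmultiples (α : ZMod n) =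
      AddSubgroup.zmultiples ((Nat.gcd d α : ℕ) : ZMod n) := by
  apply le_antisymm
  · refine sup_le ?_ ?_ <;> rw [AddSubgroup.zmultiples_le]
    · obtain ⟨q, hq⟩ := Nat.gcd_dvd_left d α
      exact ⟨q, by rw [mul_comm] at hq; nth_rw 2 [hq]; simp⟩
    · obtain ⟨q, hq⟩ := Nat.gcd_dvd_right d α
      exact ⟨q, by rw [mul_comm] at hq; nth_rw 2 [hq]; simp⟩
  · rw [AddSubgroup.zmultiples_le]
    have h := congrArg (Int.cast : ℤ → ZMod n) (Nat.gcd_eq_gcd_ab d α)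
    push_cast at h
    rw [h]
    refine AddSubgroup.add_mem_sup ⟨Nat.gcdA d α, ?_⟩ ⟨Nat.gcdB d α, ?_⟩ <;>
      simp [mul_comm]

theorem PClass_eq_circMat [NeZero n] (a d : ℕ) :
    PClass n a d = circMat {g | g - (a : ZMod n) ∈ AddSubgroup.zmultiples (d : ZMod n)} := by
  classical
  rw [PClass]
  simp only [P_pow_eq_circMat]
  rw [circMat_sum]
  · congr 1
    ext g
    simp only [Set.mem_ofPred_eq, mem_zmultiples_iff_mem_range_addOrderOf, Finset.mem_image,
      Set.mem_singleton_iff]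
    refine exists_congr fun t => and_congr_right fun _ => ?_
    push_cast
    rw [eq_sub_iff_add_eq', eq_comm, nsmul_eq_mul]
  · intro t ht u hu g h1 h2
    rw [Finset.mem_range] at ht hu
    rw [Set.mem_singleton_iff] at h1 h2
    rw [h1] at h2
    push_cast at h2
    refine nsmul_eq_nsmul_of_lt (x := (d : ZMod n)) (by omega) (by omega) ?_
    simpa using h2

theorem PClassClass_eq_circMat [NeZero n] {c d : ℕ} (g₀ : ℕ) (hcd : c ∣ d) (hd : d ∣ n) :
    PClassClass n g₀ c d =
      circMat {g | g - (g₀ : ZMod n) ∈ AddSubgroup.zmultiples (c : ZMod n)} := by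
  classical
  have hd0 : d ≠ 0 := fun h => NeZero.ne n (by simpa [h] using hd)
  have : NeZero d := ⟨hd0⟩
  rw [PClassClass, Nat.gcd_eq_right hd]
  simp only [PClass_eq_circMat]
  rw [circMat_sum]
  · congr 1
    ext g
    simp only [Set.mem_ofPred_eq, Finset.mem_range]
    constructor
    · rintro ⟨t, -, ht⟩
      have hle : AddSubgroup.zmultiples (d : ZMod n) ≤ AddSubgroup.zmultiples (c : ZMod n) := by
        rw [AddSubgroup.zmultiples_le]
        obtain ⟨q, rfl⟩ := hcd
        exact ⟨q, by simp [mul_comm]⟩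
      have := add_mem (hle ht) (nsmul_mem (AddSubgroup.mem_zmultiples (c : ZMod n)) t)
      push_cast at this
      rwa [nsmul_eq_mul, show g - (g₀ + t * c) + t * (c : ZMod n) = g - g₀ by ring] at this
    · rintro ⟨z, hz⟩
      have hzm : z • (c : ZMod d) ∈ AddSubgroup.zmultiples (c : ZMod d) := ⟨z, rfl⟩
      rw [mem_zmultiples_iff_mem_range_addOrderOf, Finset.mem_image] at hzm
      obtain ⟨t, ht, htz⟩ := hzm
      refine ⟨t, Finset.mem_range.1 ht, ?_⟩
      have h1 : ((t * c : ℤ) : ZMod d) = ((z * c : ℤ) : ZMod d) := by simpa using htz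
      rw [ZMod.intCast_eq_intCast_iff_dvd_sub] at h1
      have h2 := (intCast_mem_zmultiples_iff hd _).2 h1
      have hz' : (z : ZMod n) * c = g - g₀ := by simpa using hz
      push_cast at h2 ⊢
      rwa [hz', show g - (g₀ : ZMod n) - t * c = g - (g₀ + t * c) by ring] at h2
  · intro t ht u hu g h1 h2
    rw [Finset.mem_range] at ht hu
    refine nsmul_injOn_Iio_addOrderOf ht hu ?_
    rw [Set.mem_ofPred_eq] at h1 h2
    have h3 := sub_mem h1 h2
    push_cast at h3
    rw [show g - (g₀ + t * c) - (g - (g₀ + u * c)) = ((u * c - t * c : ℤ) : ZMod n) by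
      push_cast; ring, intCast_mem_zmultiples_iff hd,
      ← ZMod.intCast_eq_intCast_iff_dvd_sub] at h3
    simpa using h3

/-- The exponents that occur in a matrix of the third family. -/
def classSet (H : AddSubgroup (ZMod n)) (β α : ZMod n) (l : ℕ) : Set (ZMod n) :=
  {g | g - β ∉ H ⊔ AddSubgroup.zmultiples α ∨ g = β ∨ ∃ t, 1 ≤ t ∧ t ≤ l ∧ g - β - t • α ∈ H}

/-- The order of `α` modulo `d` is `d / gcd(d, α)`. -/
theorem nsmul_notMem_zmultiples {d α l : ℕ} (hd : d ∣ n) (hl : l < d / Nat.gcd d α) (t : ℕ)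
    (h1 : 1 ≤ t) (h2 : t ≤ l) :
    t • (α : ZMod n) ∉ AddSubgroup.zmultiples (d : ZMod n) := by
  intro h
  rw [show t • (α : ZMod n) = (((t * α : ℕ) : ℤ) : ZMod n) by push_cast; rw [nsmul_eq_mul],
    intCast_mem_zmultiples_iff hd, Int.natCast_dvd_natCast] at h
  have hpos : 0 < Nat.gcd d α := by
    by_contra h0
    rw [show Nat.gcd d α = 0 by omega, Nat.div_zero] at hl
    omega
  have h4 : d / Nat.gcd d α ∣ t * (α / Nat.gcd d α) := by
    refine Nat.dvd_of_mul_dvd_mul_right hpos ?_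
    rwa [Nat.div_mul_cancel (Nat.gcd_dvd_left _ _), mul_assoc,
      Nat.div_mul_cancel (Nat.gcd_dvd_right _ _)]
  have h5 := (Nat.coprime_div_gcd_div_gcd hpos).dvd_of_dvd_mul_right h4
  have := Nat.le_of_dvd (by omega) h5
  omega

theorem sum_eq_circMat_classSet [NeZero n] {d α β l c : ℕ} {γ : Fin (c - 1) → ℕ} (hd : d ∣ n)
    (hc : c = Nat.gcd d α) (hl : l < d / c) (hγ : ∀ j j', γ j ≡ γ j' [MOD c] → j = j')
    (hγβ : ∀ j, ¬ γ j ≡ β [MOD c]) :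
    ∑ j, PClassClass n (γ j) c d + P n ^ β + ∑ t ∈ Finset.Icc 1 l, PClass n (β + t * α) d =
      circMat (classSet (AddSubgroup.zmultiples (d : ZMod n)) (β : ZMod n) (α : ZMod n) l) := by
  have hcd : c ∣ d := hc ▸ Nat.gcd_dvd_left _ _
  have hcn : c ∣ n := hcd.trans hd
  have hc0 : c ≠ 0 := fun h => NeZero.ne n (by simpa [h] using hcn)
  have : NeZero c := ⟨hc0⟩
  have hα := nsmul_notMem_zmultiples hd (hc ▸ hl)
  have hK := zmultiples_sup_zmultiples_natCast (n := n) d α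
  rw [← hc] at hK
  have hHK : AddSubgroup.zmultiples (d : ZMod n) ≤ AddSubgroup.zmultiples (c : ZMod n) :=
    hK ▸ le_sup_left
  have hαK : (α : ZMod n) ∈ AddSubgroup.zmultiples (c : ZMod n) :=
    hK ▸ AddSubgroup.mem_sup_right (AddSubgroup.mem_zmultiples _)
  have hmod : ∀ a b : ℕ, (a : ZMod n) - b ∈ AddSubgroup.zmultiples (c : ZMod n) ↔
      a ≡ b [MOD c] := fun a b => by
    rw [show (a : ZMod n) - b = ((a - b : ℤ) : ZMod n) by push_cast; rfl,
      intCast_mem_zmultiples_iff hcn, ← ZMod.natCast_eq_natCast_iff,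
      ← ZMod.intCast_zmod_eq_zero_iff_dvd]
    push_cast
    rw [sub_eq_zero]
  simp only [PClassClass_eq_circMat _ hcd hd, PClass_eq_circMat, P_pow_eq_circMat]
  rw [circMat_sum, circMat_sum, circMat_add, circMat_add]
  · congr 1
    ext g
    have hfirst : (∃ j, g - (γ j : ZMod n) ∈ AddSubgroup.zmultiples (c : ZMod n)) ↔
        g - β ∉ AddSubgroup.zmultiples (c : ZMod n) := by
      constructor
      · rintro ⟨j, hj⟩ hβ
        refine hγβ j ((hmod _ _).1 ?_)
        have := sub_mem hβ hj
        rwa [sub_sub_sub_cancel_left] at this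
      · intro hβ
        -- `β` and the `γ j` are `c` pairwise incongruent numbers, hence a complete residue system
        -- modulo `c`.
        let f : Option (Fin (c - 1)) → ZMod c := fun o => o.elim (β : ZMod c) fun j => (γ j : ZMod c)
        have hf : Function.Injective f := by
          rintro (_ | i) (_ | j) h
          · rfl
          · exact (hγβ j ((ZMod.natCast_eq_natCast_iff _ _ _).1 h.symm)).elim
          · exact (hγβ i ((ZMod.natCast_eq_natCast_iff _ _ _).1 h)).elim
          · rw [hγ i j ((ZMod.natCast_eq_natCast_iff _ _ _).1 h)]
        have hsurj := ((Fintype.bijective_iff_injective_and_card f).2 ⟨hf, by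
          rw [Fintype.card_option, Fintype.card_fin, ZMod.card]; omega⟩).2
        obtain ⟨o, ho⟩ := hsurj (g.val : ZMod c)
        rcases o with _ | j
        · refine (hβ ?_).elim
          have := (hmod g.val β).2 ((ZMod.natCast_eq_natCast_iff _ _ _).1 ho.symm)
          simpa using this
        · refine ⟨j, ?_⟩
          have := (hmod g.val (γ j)).2 ((ZMod.natCast_eq_natCast_iff _ _ _).1 ho.symm)
          simpa using this
    simp only [classSet, hK, Set.mem_union, Set.mem_ofPred_eq, Finset.mem_univ, true_and, hfirst,
      Set.mem_singleton_iff, or_assoc, Finset.mem_Icc, and_assoc]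
    push_cast
    simp only [sub_add_eq_sub_sub, nsmul_eq_mul]
  · rw [Set.disjoint_left]
    rintro g (⟨j, -, hj⟩ | hg) ⟨t, ht, hgt⟩
    · refine hγβ j ((hmod _ _).1 ?_)
      have h1 := add_mem (hHK hgt) (nsmul_mem hαK t)
      have := sub_mem h1 hj
      push_cast at this
      rwa [nsmul_eq_mul, show g - (β + t * α) + t * (α : ZMod n) - (g - γ j) = γ j - β by
        ring] at this
    · rw [Finset.mem_Icc] at ht
      rw [Set.mem_singleton_iff] at hg
      refine hα t ht.1 ht.2 ?_
      rw [Set.mem_ofPred_eq] at hgt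
      have := neg_mem hgt
      push_cast at this
      rwa [hg, show -((β : ZMod n) - (β + t * α)) = t • (α : ZMod n) by
        rw [nsmul_eq_mul]; ring] at this
  · rw [Set.disjoint_left]
    rintro g ⟨j, -, hj⟩ hg
    rw [Set.mem_singleton_iff] at hg
    refine hγβ j ((hmod _ _).1 ?_)
    rw [Set.mem_ofPred_eq] at hj
    have := neg_mem hj
    rwa [hg, neg_sub] at this
  · have hlt : ∀ t u : ℕ, u ≤ l → t < u → ∀ g : ZMod n,
        g - ((β + t * α : ℕ) : ZMod n) ∈ AddSubgroup.zmultiples (d : ZMod n) →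
        g - ((β + u * α : ℕ) : ZMod n) ∈ AddSubgroup.zmultiples (d : ZMod n) → False := by
      intro t u hu htu g h1 h2
      obtain ⟨v, rfl⟩ := Nat.exists_eq_add_of_lt htu
      refine hα (v + 1) (by omega) (by omega) ?_
      have := sub_mem h1 h2
      push_cast at this
      rwa [show g - (β + t * α) - (g - (β + (t + v + 1) * α)) = (v + 1) • (α : ZMod n) by
        rw [nsmul_eq_mul]; push_cast; ring] at this
    intro t ht u hu g h1 h2
    rw [Finset.mem_Icc] at ht hu
    rcases lt_trichotomy t u with h | h | h
    · exact (hlt t u hu.2 h g h1 h2).elim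
    · exact h
    · exact (hlt u t ht.2 h g h2 h1).elim
  · intro i _ j _ g h1 h2
    refine hγ i j ((hmod _ _).1 ?_)
    rw [Set.mem_ofPred_eq] at h1 h2
    have := sub_mem h2 h1
    rwa [sub_sub_sub_cancel_left] at this

end Families

/-! ### Regularity and connectedness -/

section Graph

variable {n : ℕ} {S : Set (ZMod n)}

theorem card_neighborSet_circMat (x : ZMod n ⊕ ZMod n) :
    Nat.card ((bipGraph (circMat S)).neighborSet x) = S.ncard := by
  rw [Nat.card_coe_set_eq]
  rcases x with r | v
  · rw [show (bipGraph (circMat S)).neighborSet (Sum.inl r) = (fun s => Sum.inr (r + s)) '' S by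
      ext (y | y)
      · simp only [SimpleGraph.mem_neighborSet, Set.mem_image, reduceCtorEq, and_false, exists_false,
          iff_false]
        exact id
      · simp only [SimpleGraph.mem_neighborSet, Set.mem_image, Sum.inr.injEq]
        refine (circMat_eq_one (i := r) (j := y)).trans ⟨fun h => ⟨_, h, by ring⟩, ?_⟩
        rintro ⟨s, hs, rfl⟩
        simpa using hs]
    exact Set.ncard_image_of_injective _ (Sum.inr_injective.comp (add_right_injective r))
  · rw [show (bipGraph (circMat S)).neighborSet (Sum.inr v) = (fun s => Sum.inl (v - s)) '' S by
      ext (y | y)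
      · simp only [SimpleGraph.mem_neighborSet, Set.mem_image, Sum.inl.injEq]
        refine (circMat_eq_one (i := y) (j := v)).trans ⟨fun h => ⟨_, h, by ring⟩, ?_⟩
        rintro ⟨s, hs, rfl⟩
        simpa using hs
      · simp only [SimpleGraph.mem_neighborSet, Set.mem_image, reduceCtorEq, and_false, exists_false,
          iff_false]
        exact id]
    exact Set.ncard_image_of_injective _ (Sum.inl_injective.comp (sub_right_injective (b := v)))

theorem isRegularOfDegree_circMat [(bipGraph (circMat S)).LocallyFinite] :
    (bipGraph (circMat S)).IsRegularOfDegree S.ncard := fun x => by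
  rw [← SimpleGraph.card_neighborSet_eq_degree, ← Nat.card_eq_fintype_card,
    card_neighborSet_circMat]

theorem IsRegularOfDegree.eq_ncard {V : Type*} {G : SimpleGraph V} [G.LocallyFinite] {k : ℕ}
    (h : G.IsRegularOfDegree k) (φ : G ≃g bipGraph (circMat S)) : k = S.ncard := by
  rw [← h (φ.symm (Sum.inl 0)), ← SimpleGraph.card_neighborSet_eq_degree,
    ← Nat.card_eq_fintype_card, Nat.card_congr (φ.mapNeighborSet _), card_neighborSet_circMat]

/-- The shifts `g` that join every row `r` to `r + g` by a path form a subgroup, and a common column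
puts each difference of elements of `S` into it. -/
theorem connected_circMat (hS : S.Nonempty)
    (h : ∀ L : AddSubgroup (ZMod n), (∀ s ∈ S, ∀ t ∈ S, s - t ∈ L) → L = ⊤) :
    (bipGraph (circMat S)).Connected := by
  let L : AddSubgroup (ZMod n) :=
    { carrier := {g | ∀ r : ZMod n,
        (bipGraph (circMat S)).Reachable (Sum.inl r) (Sum.inl (r + g))}
      zero_mem' := fun r => by rw [add_zero]
      add_mem' := fun {a b} ha hb r => by
        rw [← add_assoc]; exact (ha r).trans (hb (r + a))
      neg_mem' := fun {a} ha r => by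
        have := (ha (r + -a)).symm
        rwa [neg_add_cancel_right] at this }
  have hL := h L fun s hs t ht r => by
    have h1 : (bipGraph (circMat S)).Adj (Sum.inl r) (Sum.inr (r + s)) :=
      circMat_eq_one.2 (by simpa using hs)
    have h2 : (bipGraph (circMat S)).Adj (Sum.inr (r + s)) (Sum.inl (r + (s - t))) :=
      circMat_eq_one.2 (by rwa [show r + s - (r + (s - t)) = t by ring])
    exact h1.reachable.trans h2.reachable
  have hrow : ∀ r, (bipGraph (circMat S)).Reachable (Sum.inl 0) (Sum.inl r) := fun r => by
    have : r ∈ L := hL ▸ AddSubgroup.mem_top r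
    have h0 := this 0
    rwa [zero_add] at h0
  obtain ⟨s, hs⟩ := hS
  have hall : ∀ x, (bipGraph (circMat S)).Reachable (Sum.inl 0) x := by
    rintro (r | v)
    · exact hrow r
    · have h1 : (bipGraph (circMat S)).Adj (Sum.inl (v - s)) (Sum.inr v) :=
        circMat_eq_one.2 (by simpa using hs)
      exact (hrow _).trans h1.reachable
  exact SimpleGraph.connected_iff_exists_forall_reachable _ |>.2 ⟨_, hall⟩

theorem connected_circMat_of_compl_coset {K : AddSubgroup (ZMod n)} (hK : K ≠ ⊤) {b : ZMod n}
    (hb : b ∈ S) (hS : ∀ g, g - b ∉ K → g ∈ S) : (bipGraph (circMat S)).Connected := by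
  refine connected_circMat ⟨b, hb⟩ fun L hL => (AddSubgroup.eq_top_iff' _).2 fun g => ?_
  have hout : ∀ g, g ∉ K → g ∈ L := fun g hg => by
    have := hL (b + g) (hS _ (by simpa using hg)) b hb
    simpa using this
  obtain ⟨w, hw⟩ : ∃ w, w ∉ K := by
    by_contra! h
    exact hK ((AddSubgroup.eq_top_iff' _).2 h)
  by_cases hg : g ∈ K
  · have := sub_mem (hout (g + w) fun h => hw (by simpa using sub_mem h hg)) (hout w hw)
    simpa using this
  · exact hout g hg

/-! ### Permutation equivalence -/

theorem PermEquiv.trans {l m : Type*} {A B C : Matrix l m ℤ} (h₁ : PermEquiv A B)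
    (h₂ : PermEquiv B C) : PermEquiv A C := by
  obtain ⟨σ, τ, rfl⟩ := h₁
  obtain ⟨σ', τ', rfl⟩ := h₂
  exact ⟨σ.trans σ', τ.trans τ', by ext; rfl⟩

theorem permEquiv_circMat_of_affine {T : Set (ZMod n)} (u : (ZMod n)ˣ) (x : ZMod n)
    (h : ∀ g, g ∈ S ↔ u * g + x ∈ T) : PermEquiv (circMat S) (circMat T) := by
  refine ⟨Units.mulLeft u, (Units.mulLeft u).trans (Equiv.addRight x), ?_⟩
  ext i j
  have := h (j - i)
  rw [show (u : ZMod n) * (j - i) + x = u * j + x - u * i by ring] at this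
  simp only [circMat, Matrix.of_apply, Matrix.submatrix_apply, Units.mulLeft_apply,
    Equiv.trans_apply, Equiv.coe_addRight]
  classical exact if_congr this rfl rfl

theorem permEquiv_circMat_transpose : PermEquiv (circMat S).transpose (circMat S) := by
  refine ⟨Equiv.neg _, Equiv.neg _, ?_⟩
  ext i j
  simp only [circMat, Matrix.of_apply, Matrix.submatrix_apply, Matrix.transpose_apply,
    Equiv.neg_apply]
  rw [show -j - -i = i - j by ring]

theorem IsZeroOne.eq_of_forall {l m : Type*} {A B : Matrix l m ℤ} (hA : IsZeroOne A)
    (hB : IsZeroOne B) (h : ∀ i j, A i j = 1 ↔ B i j = 1) : A = B := by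
  ext i j
  have := h i j
  rcases hA i j with h1 | h1 <;> rcases hB i j with h2 | h2 <;> simp_all

theorem isLeft_ne_of_adj {l m : Type*} {A : Matrix l m ℤ} {x y : l ⊕ m}
    (h : (bipGraph A).Adj x y) : x.isLeft ≠ y.isLeft := by
  rcases x with x | x <;> rcases y with y | y
  · exact h.elim
  · simp
  · simp
  · exact h.elim

/-- Along an edge an isomorphism keeps the sides of both ends or of neither; connectedness makes
this uniform. If sides are swapped, the transpose appears. -/
theorem permEquiv_of_iso {m : Type*} [Finite m] {A B : Matrix m m ℤ} (hA : IsZeroOne A)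
    (hB : IsZeroOne B) (hconn : (bipGraph A).Connected) (φ : bipGraph A ≃g bipGraph B) :
    PermEquiv A B ∨ PermEquiv A B.transpose := by
  have hadj : ∀ x y, (bipGraph A).Adj x y →
      ((φ x).isLeft = x.isLeft ↔ (φ y).isLeft = y.isLeft) := by
    intro x y h
    have h1 := isLeft_ne_of_adj h
    have h2 := isLeft_ne_of_adj (φ.map_adj_iff.2 h)
    revert h1 h2
    cases (φ x).isLeft <;> cases (φ y).isLeft <;> cases x.isLeft <;> cases y.isLeft <;> simp
  have hreach : ∀ x y, ((φ x).isLeft = x.isLeft ↔ (φ y).isLeft = y.isLeft) := by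
    intro x y
    obtain ⟨p⟩ := hconn.preconnected x y
    induction p with
    | nil => exact Iff.rfl
    | cons h _ ih => exact (hadj _ _ h).trans ih
  have hside : (∀ x, (φ x).isLeft = x.isLeft) ∨ ∀ x, (φ x).isLeft ≠ x.isLeft := by
    by_contra! h
    obtain ⟨⟨x, hx⟩, y, hy⟩ := h
    exact hx ((hreach x y).2 hy)
  rcases hside with h | h
  · left
    have h1 : ∀ i, ∃ j, φ (Sum.inl i) = Sum.inl j := fun i => Sum.isLeft_iff.1 (by simp [h])
    have h2 : ∀ i, ∃ j, φ (Sum.inr i) = Sum.inr j := fun i => Sum.isRight_iff.1 (by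
      have := h (Sum.inr i)
      cases hc : φ (Sum.inr i) <;> simp_all)
    choose σ hσ using h1
    choose τ hτ using h2
    have iσ : Function.Injective σ := fun i j hij => Sum.inl_injective (φ.injective (by
      rw [hσ, hσ, hij]))
    have iτ : Function.Injective τ := fun i j hij => Sum.inr_injective (φ.injective (by
      rw [hτ, hτ, hij]))
    refine ⟨Equiv.ofBijective σ (Finite.injective_iff_bijective.1 iσ),
      Equiv.ofBijective τ (Finite.injective_iff_bijective.1 iτ),
      hA.eq_of_forall (fun i j => hB _ _) fun i j => ?_⟩
    have := φ.map_adj_iff (v := Sum.inl i) (w := Sum.inr j)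
    rw [hσ, hτ] at this
    exact this.symm
  · right
    have h1 : ∀ i, ∃ j, φ (Sum.inl i) = Sum.inr j := fun i => Sum.isRight_iff.1 (by
      have := h (Sum.inl i)
      cases hc : φ (Sum.inl i) <;> simp_all)
    have h2 : ∀ i, ∃ j, φ (Sum.inr i) = Sum.inl j := fun i => Sum.isLeft_iff.1 (by
      have := h (Sum.inr i)
      cases hc : φ (Sum.inr i) <;> simp_all)
    choose σ hσ using h1
    choose τ hτ using h2
    have iσ : Function.Injective σ := fun i j hij => Sum.inl_injective (φ.injective (by
      rw [hσ, hσ, hij]))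
    have iτ : Function.Injective τ := fun i j hij => Sum.inr_injective (φ.injective (by
      rw [hτ, hτ, hij]))
    refine ⟨Equiv.ofBijective σ (Finite.injective_iff_bijective.1 iσ),
      Equiv.ofBijective τ (Finite.injective_iff_bijective.1 iτ),
      hA.eq_of_forall (fun i j => hB _ _) fun i j => ?_⟩
    have := φ.map_adj_iff (v := Sum.inl i) (w := Sum.inr j)
    rw [hσ, hτ] at this
    exact this.symm

end Graph

/-! ### Classification -/

section Classification

variable {n : ℕ} {S : Set (ZMod n)}

theorem zmultiples_natCast_eq_gcd (i : ℕ) : AddSubgroup.zmultiples (i : ZMod n) =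
    AddSubgroup.zmultiples ((Nat.gcd n i : ℕ) : ZMod n) := by
  rw [← zmultiples_sup_zmultiples_natCast, ZMod.natCast_self, AddSubgroup.zmultiples_zero_eq_bot,
    bot_sup_eq]

theorem zmultiples_eq_top_iff_of_dvd [NeZero n] {d : ℕ} (hd : d ∣ n) :
    AddSubgroup.zmultiples (d : ZMod n) = ⊤ ↔ d = 1 := by
  constructor
  · intro h
    have h1 : ((1 : ℤ) : ZMod n) ∈ AddSubgroup.zmultiples (d : ZMod n) := h ▸ AddSubgroup.mem_top _
    rw [intCast_mem_zmultiples_iff hd] at h1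
    exact_mod_cast Int.eq_one_of_dvd_one (by omega) h1
  · rintro rfl
    refine (AddSubgroup.eq_top_iff' _).2 fun g => ⟨g.val, by simp⟩

theorem zmultiples_natCast_eq_top_iff [NeZero n] (i : ℕ) :
    AddSubgroup.zmultiples (i : ZMod n) = ⊤ ↔ Nat.gcd i n = 1 := by
  rw [zmultiples_natCast_eq_gcd, zmultiples_eq_top_iff_of_dvd (Nat.gcd_dvd_left _ _),
    Nat.gcd_comm]

theorem ncard_progression {b x : ZMod n} {l : ℕ} (hl : l < addOrderOf x)
    (hS : ∀ g, g ∈ S ↔ ∃ t ≤ l, g = b + t • x) : S.ncard = l + 1 := by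
  have hS' : S = (fun t : ℕ => b + t • x) '' (Finset.range (l + 1) : Finset ℕ) := by
    ext g
    rw [hS]
    simp [eq_comm]
  rw [hS', Set.InjOn.ncard_image, Set.ncard_coe_finset, Finset.card_range]
  intro t ht u hu h
  simp only [Finset.coe_range, Set.mem_Iio] at ht hu
  exact nsmul_eq_nsmul_of_lt (by omega) (by omega) (add_left_cancel h)

theorem exists_family1_of_progression [NeZero n] {b x : ZMod n} {l : ℕ} (hx : AddSubgroup.zmultiples x = ⊤)
    (hl : l < addOrderOf x) (h2 : 2 ≤ S.ncard) (hS : ∀ g, g ∈ S ↔ ∃ t ≤ l, g = b + t • x) :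
    ∃ M, IsFamily1 n S.ncard M ∧ PermEquiv (circMat S) M := by
  have hcard := ncard_progression hl hS
  have hle := ncard_le_card S
  refine ⟨_, ⟨h2, hle, rfl⟩, ?_⟩
  rw [sum_P_pow_eq_circMat hle, hcard]
  -- `z` inverts the generator `x`, and `g ↦ z * (g - b)` carries the progression to `0, …, l`.
  obtain ⟨z, hz⟩ : (1 : ZMod n) ∈ AddSubgroup.zmultiples x := hx ▸ AddSubgroup.mem_top _
  have hz' : (z : ZMod n) * x = 1 := by simpa using hz
  refine permEquiv_circMat_of_affine (Units.mkOfMulEqOne _ _ hz') (-(z * b)) fun g => ?_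
  rw [hS, Units.val_mkOfMulEqOne, Set.mem_ofPred_eq]
  refine exists_congr fun t => and_congr Nat.lt_succ_iff.symm ?_
  constructor
  · rintro rfl
    rw [nsmul_eq_mul]
    linear_combination (t : ZMod n) * hz'
  · intro h
    rw [nsmul_eq_mul]
    linear_combination x * h + (b - g) * hz'

theorem isFamily2_of_compl_progression [NeZero n] {a x : ZMod n} {r : ℕ} (hx : AddSubgroup.zmultiples x ≠ ⊤)
    (hr : r + 1 < addOrderOf x) (hS : ∀ g, g ∉ S ↔ ∃ t ≤ r, g = a + t • x) :
    IsFamily2 n (circMat S) := by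
  have hxv : ((x.val : ℕ) : ZMod n) = x := ZMod.natCast_zmod_val x
  refine ⟨a.val, r, x.val, ?_, by rwa [hxv], ?_⟩
  · have h1 : Nat.gcd x.val n ≠ 1 := fun h => hx (by
      rw [← hxv]; exact (zmultiples_natCast_eq_top_iff _).2 h)
    have h2 := Nat.gcd_pos_of_pos_right x.val (NeZero.pos n)
    omega
  · rw [J_sub_sum_P_pow_eq_circMat (by rw [hxv]; omega), hxv, ZMod.natCast_zmod_val]
    congr 1
    ext g
    rw [Set.mem_compl_iff, Set.mem_ofPred_eq, ← hS, not_not]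

theorem exists_family3_of_classes [NeZero n] {H : AddSubgroup (ZMod n)} {b α : ZMod n} {l : ℕ} (hH : H ≠ ⊥)
    (hl : 1 ≤ l) (hα : ∀ t, 1 ≤ t → t ≤ l + 1 → t • α ∉ H)
    (hS : ∀ g, g ∈ S ↔ g - b ∉ H ⊔ AddSubgroup.zmultiples α ∨ g = b ∨
        ∃ t, 1 ≤ t ∧ t ≤ l ∧ g - b - t • α ∈ H)
    (hforce : ∃ s₀ ∈ S, ∀ R C, Stalled S R C → (∀ s ∈ S, s₀ - s ∈ R) → S ⊆ C →
      R = Set.univ ∧ C = Set.univ) :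
    ∃ M, IsFamily3 n M ∧ PermEquiv (circMat S) M := by
  obtain ⟨d, hd, rfl⟩ : ∃ d : ℕ, d ∣ n ∧ H = AddSubgroup.zmultiples (d : ZMod n) := by
    obtain ⟨z, rfl⟩ := H.isAddCyclic_iff_exists_zmultiples_eq_top.1 inferInstance
    refine ⟨Nat.gcd n z.val, Nat.gcd_dvd_left _ _, ?_⟩
    rw [← zmultiples_natCast_eq_gcd, ZMod.natCast_zmod_val]
  obtain ⟨a, rfl⟩ : ∃ a : ℕ, (a : ZMod n) = α := ⟨α.val, ZMod.natCast_zmod_val α⟩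
  have hd0 : 0 < d := Nat.pos_of_dvd_of_pos hd (NeZero.pos n)
  have hc0 : 0 < Nat.gcd d a := Nat.gcd_pos_of_pos_left _ hd0
  have hdc : l + 1 < d / Nat.gcd d a := by
    by_contra hcon
    refine hα (d / Nat.gcd d a) (Nat.div_pos (Nat.gcd_le_left _ hd0) hc0) (by omega) ?_
    rw [show (d / Nat.gcd d a) • (a : ZMod n) = (((d / Nat.gcd d a * a : ℕ) : ℤ) : ZMod n) by
      rw [Int.cast_natCast, Nat.cast_mul, nsmul_eq_mul], intCast_mem_zmultiples_iff hd,
      Int.natCast_dvd_natCast]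
    refine ⟨a / Nat.gcd d a, ?_⟩
    rw [Nat.div_mul_right_comm (Nat.gcd_dvd_left _ _), Nat.mul_div_assoc _ (Nat.gcd_dvd_right _ _)]
  -- `S` may be translated, so `β` is free and is chosen below to satisfy (a) or (b).
  have hperm : ∀ β : ZMod n, PermEquiv (circMat S)
      (circMat (classSet (AddSubgroup.zmultiples (d : ZMod n)) β (a : ZMod n) l)) := fun β => by
    refine permEquiv_circMat_of_affine 1 (β - b) fun g => ?_
    rw [hS, classSet, Set.mem_ofPred_eq, Units.val_one, one_mul,
      show g + (β - b) - β = g - b by ring]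
    refine or_congr Iff.rfl (or_congr ⟨?_, ?_⟩ Iff.rfl)
    · rintro rfl; ring
    · intro h; linear_combination h
  by_cases hc1 : Nat.gcd d a = 1
  · rw [hc1, Nat.div_one] at hdc
    have hK : AddSubgroup.zmultiples (d : ZMod n) ⊔ AddSubgroup.zmultiples (a : ZMod n) = ⊤ := by
      rw [zmultiples_sup_zmultiples_natCast, hc1]
      exact (zmultiples_eq_top_iff_of_dvd (one_dvd n)).2 rfl
    obtain ⟨s₀, hs₀, hforce⟩ := hforce
    obtain ⟨t, ht1, ht2, ht⟩ := exists_nsmul_mem_of_forcing (b := b) (α := a) hH (fun g => by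
      rw [hS g, hK]; simp) hl hs₀ hforce
    have hdt : d ≤ t := by
      by_contra hlt
      refine nsmul_notMem_zmultiples (n := n) (l := t) (α := a) hd ?_ t ht1 le_rfl ht
      rw [hc1, Nat.div_one]; omega
    -- `β = -α` corresponds to `m = 1`, for which (b) asks for `d ≤ 2 * l`; with `l + 1 < d` this
    -- also gives `1 < l`.
    refine ⟨_, ⟨d, a, (-(a : ZMod n)).val, l, 1, Fin.elim0, hd, hc1.symm, hl,
      by rw [Nat.div_one]; omega, fun j => j.elim0, fun j => j.elim0,
      Or.inr ⟨1, le_rfl, by omega, ⟨0, by simp⟩, by rw [Nat.div_one]; omega⟩, rfl⟩, ?_⟩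
    rw [sum_eq_circMat_classSet hd hc1.symm (by rw [Nat.div_one]; omega) (fun j => j.elim0)
      (fun j => j.elim0)]
    exact hperm _
  · have hγ : ∀ j j' : Fin (Nat.gcd d a - 1), (j : ℕ) ≡ j' [MOD Nat.gcd d a] → j = j' :=
      fun j j' h => Fin.ext (Nat.ModEq.eq_of_lt_of_lt h (by omega) (by omega))
    have hγβ : ∀ j : Fin (Nat.gcd d a - 1), ¬ (j : ℕ) ≡ Nat.gcd d a - 1 [MOD Nat.gcd d a] :=
      fun j h => by
        have := Nat.ModEq.eq_of_lt_of_lt h (by omega) (by omega)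
        omega
    -- With `γ j = j` and `β = c - 1`, the multiple `α` of `c` lies in the double class of `γ 0 =
    -- 0`.
    refine ⟨_, ⟨d, a, Nat.gcd d a - 1, l, Nat.gcd d a, fun j => j, hd, rfl, hl, by omega, hγ, hγβ,
      Or.inl ⟨⟨0, by omega⟩, a / Nat.gcd d a, 0, ?_⟩, rfl⟩, ?_⟩
    · have := congrArg (Nat.cast : ℕ → ZMod n) (Nat.div_mul_cancel (Nat.gcd_dvd_right d a))
      push_cast at this ⊢
      rw [this]; ring
    · rw [sum_eq_circMat_classSet hd rfl (by omega) hγ hγβ]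
      exact hperm _

theorem zeroForcingNumber_pos {V : Type*} [Fintype V] [Nonempty V] (G : SimpleGraph V) :
    0 < zeroForcingNumber G := by
  obtain ⟨B, hB, hz⟩ := exists_card_eq_zeroForcingNumber G
  by_contra h
  have h0 : B = ∅ := Finset.card_eq_zero.1 (by omega)
  have := isZeroForcingSet_iff.1 hz ∅ (fun u hu => hu.elim) (by simp [h0])
  exact Set.empty_ne_univ this

/-- The classification of the circulants that attain the bound. -/
theorem exists_family [NeZero n] (hZ : zeroForcingNumber (bipGraph (circMat S)) = 2 * (S.ncard - 1)) :
    ∃ M, (IsFamily1 n S.ncard M ∨ IsFamily2 n M ∨ IsFamily3 n M) ∧ PermEquiv (circMat S) M := by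
  -- This excludes `k ≤ 1`, where the truncated `2 * (k - 1)` would be `0`.
  have hpos := zeroForcingNumber_pos (bipGraph (circMat S))
  have hk : 2 ≤ S.ncard := by omega
  have hle := ncard_le_card S
  have hforce := exists_forcing_pair (by omega) hZ
  obtain ⟨s₀, hs₀, hf⟩ := id hforce
  have hE : ∀ C, S ⊆ C → C ≠ Set.univ →
      ∃ r, ∃ s ∈ S, r + s ∉ C ∧ ∀ s' ∈ S, s' ≠ s → r + s' ∈ C := fun C hC hne =>
    exists_unique_white_row fun hst => hne (hf _ _ hst (fun _ _ => Set.mem_univ _) hC).2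
  have hnt : S.Nontrivial := (Set.one_lt_ncard_iff_nontrivial).1 hk
  rcases exists_structure hnt hE with h | ⟨b, x, l, hx, hl, h⟩ | ⟨a, x, r, hx, hr, h⟩ |
    ⟨H, b, α, l, hH, hl, hα, h⟩
  · obtain ⟨M, hM, hp⟩ := exists_family1_of_progression (S := S) (b := 0) (x := 1) (l := n - 1)
      ((AddSubgroup.eq_top_iff' _).2 fun g => ⟨g.val, by simp⟩)
      (by rw [ZMod.addOrderOf_one]; have := NeZero.pos n; omega) hk fun g => by
        simp only [h, Set.mem_univ, true_iff]
        exact ⟨g.val, Nat.le_sub_one_of_lt g.val_lt, by simp⟩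
    exact ⟨M, Or.inl hM, hp⟩
  · obtain ⟨M, hM, hp⟩ := exists_family1_of_progression hx (by omega) hk h
    exact ⟨M, Or.inl hM, hp⟩
  · exact ⟨_, Or.inr (Or.inl (isFamily2_of_compl_progression hx hr h)), 1, 1, by ext; rfl⟩
  · obtain ⟨M, hM, hp⟩ := exists_family3_of_classes hH hl hα h hforce
    exact ⟨M, Or.inr (Or.inr hM), hp⟩

/-! ### The three families attain the bound -/

theorem IsFamily1.exists_eq_circMat [NeZero n] {k : ℕ} {M : Matrix (ZMod n) (ZMod n) ℤ}
    (hM : IsFamily1 n k M) : ∃ S : Set (ZMod n), M = circMat S ∧ (bipGraph (circMat S)).Connected ∧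
      zeroForcingNumber (bipGraph (circMat S)) = 2 * (S.ncard - 1) := by
  obtain ⟨h2, hk, rfl⟩ := hM
  refine ⟨_, sum_P_pow_eq_circMat hk, ?_, zeroForcingNumber_interval h2 hk fun g => Iff.rfl⟩
  refine connected_circMat ⟨0, 0, by omega, by simp⟩ fun L hL =>
    (AddSubgroup.eq_top_iff' _).2 fun g => ?_
  have h1 := hL 1 ⟨1, by omega, by simp⟩ 0 ⟨0, by omega, by simp⟩
  have := nsmul_mem h1 g.val
  simpa using this

theorem IsFamily2.exists_eq_circMat [NeZero n] {M : Matrix (ZMod n) (ZMod n) ℤ}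
    (hM : IsFamily2 n M) : ∃ S : Set (ZMod n), M = circMat S ∧ (bipGraph (circMat S)).Connected ∧
      zeroForcingNumber (bipGraph (circMat S)) = 2 * (S.ncard - 1) := by
  obtain ⟨a, r, i, hi, hr, rfl⟩ := hM
  have hK : AddSubgroup.zmultiples (i : ZMod n) ≠ ⊤ := fun h => by
    rw [zmultiples_natCast_eq_top_iff] at h; omega
  refine ⟨_, J_sub_sum_P_pow_eq_circMat hr.le, ?_,
    zeroForcingNumber_compl_progression hK hr fun g => by rw [Set.mem_compl_iff, not_not]; rfl⟩
  refine connected_circMat_of_compl_coset hK (b := a + (r + 1) • (i : ZMod n)) ?_ ?_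
  · rintro ⟨t, ht, h⟩
    have := nsmul_eq_nsmul_of_lt hr (by omega) (add_left_cancel h)
    omega
  · rintro g hg ⟨t, ht, rfl⟩
    refine hg ?_
    rw [add_sub_add_left_eq_sub]
    exact sub_mem (nsmul_mem (AddSubgroup.mem_zmultiples _) _)
      (nsmul_mem (AddSubgroup.mem_zmultiples _) _)

theorem IsFamily3.exists_eq_circMat [NeZero n] {M : Matrix (ZMod n) (ZMod n) ℤ}
    (hM : IsFamily3 n M) : ∃ S : Set (ZMod n), M = circMat S ∧ (bipGraph (circMat S)).Connected ∧
      zeroForcingNumber (bipGraph (circMat S)) = 2 * (S.ncard - 1) := by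
  obtain ⟨d, α, β, l, c, γ, hd, hc, hl, hlc, hγ, hγβ, hcond, rfl⟩ := hM
  have hα := nsmul_notMem_zmultiples (n := n) hd (hc ▸ hlc)
  have hK := zmultiples_sup_zmultiples_natCast (n := n) d α
  have hcn : Nat.gcd d α ∣ n := (Nat.gcd_dvd_left _ _).trans hd
  refine ⟨_, sum_eq_circMat_classSet hd hc hlc hγ hγβ, ?_⟩
  have hβ : (β : ZMod n) ∈ classSet (AddSubgroup.zmultiples (d : ZMod n)) (β : ZMod n) α l :=
    Or.inr (Or.inl rfl)
  by_cases hc1 : c = 1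
  · have htop : AddSubgroup.zmultiples (d : ZMod n) ⊔ AddSubgroup.zmultiples (α : ZMod n) = ⊤ := by
      rw [hK, zmultiples_eq_top_iff_of_dvd hcn, ← hc, hc1]
    subst hc1
    rw [Nat.div_one] at hlc
    -- For `c = 1` there is no `γ`, so (b) holds, and `m ≥ 1` turns its inequality into `d ≤ 2 * l`.
    obtain ⟨m, hm1, hml, -, hdm⟩ := hcond.resolve_left fun ⟨j, _⟩ => j.elim0
    rw [Nat.div_one] at hdm
    refine ⟨connected_circMat ⟨_, hβ⟩ fun L hL => ?_,
      zeroForcingNumber_classes_of_eq_top hl hα htop (q := d) (by omega) (by omega) ?_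
        fun g => Iff.rfl⟩
    · have hmem : ∀ h ∈ AddSubgroup.zmultiples (d : ZMod n), (α : ZMod n) + h ∈ L := fun h hh => by
        have := hL (β + (α + h)) (Or.inr (Or.inr ⟨1, le_rfl, hl, by simpa using hh⟩)) β hβ
        simpa using this
      have hαL : (α : ZMod n) ∈ L := by simpa using hmem 0 (zero_mem _)
      rw [eq_top_iff, ← htop]
      refine sup_le (fun h hh => ?_) ((AddSubgroup.zmultiples_le).2 hαL)
      simpa using sub_mem (hmem h hh) hαL
    · rw [nsmul_eq_mul, mul_comm, ← nsmul_eq_mul]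
      exact nsmul_mem (AddSubgroup.mem_zmultiples _) _
  · have hne : AddSubgroup.zmultiples (d : ZMod n) ⊔ AddSubgroup.zmultiples (α : ZMod n) ≠ ⊤ := by
      rw [hK, Ne, zmultiples_eq_top_iff_of_dvd hcn, ← hc]
      exact hc1
    exact ⟨connected_circMat_of_compl_coset hne hβ fun g hg => Or.inl hg,
      zeroForcingNumber_classes_of_ne_top hα hne fun g => Iff.rfl⟩

end Classification

end BipCirc

/-! ### The classification theorem -/

theorem mainTheorem1 (n : ℕ) [NeZero n] :
    (∀ (k : ℕ) (V : Type*) [Fintype V] (G : SimpleGraph V) [G.LocallyFinite],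
      IsBipartiteCirculant G n → G.Connected → G.IsRegularOfDegree k →
      zeroForcingNumber G = 2 * (k - 1) →
        ∃ M : Matrix (ZMod n) (ZMod n) ℤ,
          (IsFamily1 n k M ∨ IsFamily2 n M ∨ IsFamily3 n M) ∧
          ∀ A : Matrix (ZMod n) (ZMod n) ℤ, IsBiadjacencyMatrix G A → PermEquiv A M) ∧
    (∀ M : Matrix (ZMod n) (ZMod n) ℤ,
      ((∃ k, IsFamily1 n k M) ∨ IsFamily2 n M ∨ IsFamily3 n M) →
        IsZeroOne M ∧ IsCirculant M ∧ (bipGraph M).Connected ∧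
        ∃ k : ℕ, (bipGraph M).IsRegularOfDegree k ∧
          zeroForcingNumber (bipGraph M) = 2 * (k - 1)) := by
  constructor
  · rintro k V _ G _ ⟨A₀, hcirc, h01, ⟨φ⟩⟩ hconn hreg hZ
    obtain ⟨S, rfl⟩ := hcirc.exists_eq_circMat h01
    obtain rfl := IsRegularOfDegree.eq_ncard hreg φ
    rw [zeroForcingNumber_congr φ] at hZ
    obtain ⟨M, hM, hp⟩ := exists_family hZ
    refine ⟨M, hM, fun A ⟨hA, ⟨ψ⟩⟩ => ?_⟩
    rcases permEquiv_of_iso hA h01 (ψ.connected_iff.1 hconn) (ψ.symm.trans φ) with h | h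
    · exact h.trans hp
    · exact (h.trans permEquiv_circMat_transpose).trans hp
  · intro M hM
    have key : ∃ S : Set (ZMod n), M = circMat S ∧ (bipGraph (circMat S)).Connected ∧
        zeroForcingNumber (bipGraph (circMat S)) = 2 * (S.ncard - 1) := by
      rcases hM with ⟨k, hM⟩ | hM | hM
      · exact hM.exists_eq_circMat
      · exact hM.exists_eq_circMat
      · exact hM.exists_eq_circMat
    obtain ⟨S, rfl, hconn, hZ⟩ := key
    exact ⟨isZeroOne_circMat S, isCirculant_circMat S, hconn, S.ncard,
      isRegularOfDegree_circMat, hZ⟩
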